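/- Let $n\ge 2$, $a\in\mathbb R\setminus\{0\}$, $\mathbb R^n_+=\{x=(x',x_n):x'\in\mathbb R^{n-1},\ x_n>0\}$, $1\le p\le\infty$ and $1/p+1/q=1$. For $f\in L^p(\mathbb R^{n-1}\times(0,\infty))$ let $$u(x,t)=\frac{x_n}{(4a^2\pi)^{n/2}}\int_0^t\!\int_{\mathbb R^{n-1}}\frac{e^{-|x-y|^2/(4a^2(t-\tau))}}{(t-\tau)^{(n+2)/2}}\,f(y',\tau)\,dy'\,d\tau,\qquad y=(y',0),$$ be the heat double-layer potential, which represents the solution of $u_t=a^2\Delta u$ in $\mathbb R^n_+\times(0,\infty)$, $u|_{t=0}=0$, $u|_{x_n=0}=f$. Let $\|f\|_{p,t}$ be the norm of $f$ in $L^p(\mathbb R^{n-1}\times(0,t))$. Fix $(x,t)\in\mathbb R^n_+\times(0,\infty)$. Then the integral defining $u$ converges absolutely, the gradient below exists, and there is a smallest constant $\mathcal W_p(x,t)$ such that $$\Big|\nabla_x\Big\{\frac{u(x,t)}{x_n}\Big\}\Big|\le \mathcal W_p(x,t)\,\|f\|_{p,t}\qquad\text{for all } f\in L^p(\mathbb R^{n-1}\times(0,\infty)).$$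 For $1<p\le\infty$ it is given by $$\mathcal W_p(x,t)=\frac{c_{n,p}}{x_n^{2+\frac{n+1}{p}}}\max_{|z|=1}\Big\{\int_{S^{n-1}}\omega_{\kappa,\lambda}\big((e_\sigma,e_n)\big)\,|(e_\sigma,e_n)|^{\frac{n+p+2}{p-1}}\,|(e_\sigma,z)|^{\frac p{p-1}}\,d\sigma\Big\}^{\frac{p-1}p},$$ where $e_\sigma$ is the unit vector from the origin to $\sigma\in S^{n-1}$, $d\sigma$ is surface measure, $e_n$ is the $n$-th coordinate vector, $$c_{n,p}=\frac{2^{1/p}(4a^2)^{1/p}}{\pi^{n/2}\,q^{\frac n2+1+\frac1p}},\quad \omega_{\kappa,\lambda}(v)=\int_{\kappa/v^2}^\infty\xi^\lambda e^{-\xi}\,d\xi,\quad \kappa=\frac{q x_n^2}{4a^2t},\quad \lambda=\frac{(n+4)q}2-2,$$ $\omega_{\kappa,\lambda}(0)=0$, and for $p=\infty$ one takes $q=1$ and replaces all expressions in $p$ by their limits as $p\to\infty$. For $p=1$ the representation is read as a limit: $\mathcal W_1(x,t)=\lim_{p\to1+}\mathcal W_p(x,t)$. For $2\le p\le\infty$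 the maximum is attained at $z=e_n$, and $$\mathcal W_p(x,t)=\frac{c_{n,p}}{x_n^{2+\frac{n+1}p}}\Big\{2\omega_{n-1}\int_0^{\pi/2}\Big\{\int_{\frac{q x_n^2}{4a^2t\cos^2\vartheta}}^\infty\xi^{\lambda}e^{-\xi}\,d\xi\Big\}\cos^{\frac{n+2(p+1)}{p-1}}\vartheta\,\sin^{n-2}\vartheta\,d\vartheta\Big\}^{\frac{p-1}p},$$ where $\omega_{n-1}$ is the area of the unit sphere in $\mathbb R^{n-1}$. In particular, $$\mathcal W_\infty(x,t)=\frac{4}{\sqrt\pi\,\Gamma\big(\frac{n-1}2\big)x_n^2}\int_0^{\pi/2}\Big\{\int_{\frac{x_n^2}{4a^2t\cos^2\vartheta}}^\infty\xi^{n/2}e^{-\xi}\,d\xi\Big\}\cos^2\vartheta\,\sin^{n-2}\vartheta\,d\vartheta.$$ -/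

import Mathlib

open scoped ENNReal Topology

noncomputable section

namespace HeatDirichlet

/-- The boundary space `ℝ^{n-1}`, with `n = m + 1`. -/
abbrev Bdry (m : ℕ) := EuclideanSpace ℝ (Fin m)

/-- The ambient space `ℝ^n`, with `n = m + 1`. The distinguished coordinate `x_n` is the last one. -/
abbrev Space (m : ℕ) := EuclideanSpace ℝ (Fin (m + 1))

/-- The unit vector `e_n` in the direction of the last coordinate. -/
def eLast (m : ℕ) : Space m := EuclideanSpace.single (Fin.last m) 1

/-- The boundary point `y = (y', 0)`. -/
def bdryPoint {m : ℕ} (y' : Bdry m) : Space m :=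
  WithLp.toLp 2 (Fin.snoc (fun i => y' i) (0 : ℝ) : Fin (m + 1) → ℝ)

/-- The integrand (without the factor in front of the integral) of the heat double layer potential:
`exp (-|x - y|² / (4 a² (t - τ))) / (t - τ)^{(n + 2) / 2} * f (y', τ)` at `w = (y', τ)`. -/
def potentialIntegrand {m : ℕ} (a : ℝ) (f : Bdry m × ℝ → ℝ) (x : Space m) (t : ℝ)
    (w : Bdry m × ℝ) : ℝ :=
  Real.exp (-(‖x - bdryPoint w.1‖ ^ 2 / (4 * a ^ 2 * (t - w.2)))) /
    (t - w.2) ^ ((((m + 1 : ℕ) : ℝ) + 2) / 2) * f w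

/-- The layer `ℝ^{n-1} × (0, t)`. -/
def layer (m : ℕ) (t : ℝ) : Set (Bdry m × ℝ) := Set.univ ×ˢ Set.Ioo 0 t

/-- The heat double layer potential with boundary density `f`. -/
def potential {m : ℕ} (a : ℝ) (f : Bdry m × ℝ → ℝ) (x : Space m) (t : ℝ) : ℝ :=
  x (Fin.last m) / (4 * a ^ 2 * Real.pi) ^ (((m + 1 : ℕ) : ℝ) / 2) *
    ∫ w in layer m t, potentialIntegrand a f x t w

/-- `f ∈ L^p (ℝ^{n-1} × (0, ∞))`. -/
def IsData {m : ℕ} (p : ℝ≥0∞) (f : Bdry m × ℝ → ℝ) : Prop :=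
  MeasureTheory.MemLp f p (MeasureTheory.volume.restrict (Set.univ ×ˢ Set.Ioi (0 : ℝ)))

/-- The norm of `f` in `L^p (ℝ^{n-1} × (0, t))`. -/
def layerNorm {m : ℕ} (p : ℝ≥0∞) (t : ℝ) (f : Bdry m × ℝ → ℝ) : ℝ :=
  (MeasureTheory.eLpNorm f p (MeasureTheory.volume.restrict (layer m t))).toReal

/-- All constants `C` for which `|∇_x (u (x, t) / x_n)| ≤ C ‖f‖_{p, t}` holds, at the given point
`(x, t)`, for every `f ∈ L^p (ℝ^{n-1} × (0, ∞))`, `u` being the potential with density `f`. -/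
def admissible {m : ℕ} (a : ℝ) (p : ℝ≥0∞) (x : Space m) (t : ℝ) : Set ℝ :=
  {C | ∀ f : Bdry m × ℝ → ℝ, IsData p f →
    ‖gradient (fun ξ : Space m => potential a f ξ t / ξ (Fin.last m)) x‖ ≤ C * layerNorm p t f}

/-- The sharp (smallest) coefficient `W_p (x, t)`. -/
def sharpCoeff {m : ℕ} (a : ℝ) (p : ℝ≥0∞) (x : Space m) (t : ℝ) : ℝ :=
  sInf (admissible a p x t)

/-- `1 / p`, equal to `0` for `p = ∞`. -/
def recip (p : ℝ≥0∞) : ℝ := (p⁻¹).toReal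

/-- The conjugate exponent `q = p / (p - 1)` of `p ∈ (1, ∞]`, equal to `1` for `p = ∞`. -/
def conj (p : ℝ≥0∞) : ℝ := if p = ∞ then 1 else p.toReal / (p.toReal - 1)

/-- The exponent `(n + p + 2) / (p - 1)`, equal to its limit `1` for `p = ∞`. -/
def weightExp (n : ℕ) (p : ℝ≥0∞) : ℝ :=
  if p = ∞ then 1 else ((n : ℝ) + p.toReal + 2) / (p.toReal - 1)

/-- The exponent `(n + 2 (p + 1)) / (p - 1)`, equal to its limit `2` for `p = ∞`. -/
def cosExp (n : ℕ) (p : ℝ≥0∞) : ℝ :=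
  if p = ∞ then 2 else ((n : ℝ) + 2 * (p.toReal + 1)) / (p.toReal - 1)

/-- `κ = q x_n² / (4 a² t)`, where `h` stands for `x_n`. -/
def kappa (a : ℝ) (p : ℝ≥0∞) (h t : ℝ) : ℝ := conj p * h ^ 2 / (4 * a ^ 2 * t)

/-- `λ = (n + 4) q / 2 - 2`. -/
def lam (n : ℕ) (p : ℝ≥0∞) : ℝ := ((n : ℝ) + 4) * conj p / 2 - 2

/-- `ω_{κ, l} (u) = ∫_{κ / u²}^∞ ξ^l e^{-ξ} dξ`; for `u = 0` the lower limit is `+∞` and the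
value is `0`. -/
def omega (κ l u : ℝ) : ℝ :=
  if u = 0 then 0 else ∫ ξ in Set.Ioi (κ / u ^ 2), ξ ^ l * Real.exp (-ξ)

/-- The constant `c_{n,p}`. -/
def cConst (n : ℕ) (a : ℝ) (p : ℝ≥0∞) : ℝ :=
  (2 : ℝ) ^ recip p * (4 * a ^ 2) ^ recip p /
    (Real.pi ^ ((n : ℝ) / 2) * conj p ^ ((n : ℝ) / 2 + 1 + recip p))

/-- The factor `c_{n,p} / x_n^{2 + (n + 1) / p}`, where `h` stands for `x_n`. -/
def prefactor (n : ℕ) (a : ℝ) (p : ℝ≥0∞) (h : ℝ) : ℝ :=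
  cConst n a p / h ^ (2 + ((n : ℝ) + 1) * recip p)

/-- The quantity
`{∫_{S^{n-1}} ω_{κ,λ} ((e_σ, e_n)) |(e_σ, e_n)|^{(n+p+2)/(p-1)} |(e_σ, z)|^{p/(p-1)} dσ}^{(p-1)/p}`
as a function of `z`; `dσ` is the surface measure of the unit sphere. -/
def sphereFunctional (m : ℕ) (a : ℝ) (p : ℝ≥0∞) (h t : ℝ) (z : Space m) : ℝ :=
  (∫ σ : Metric.sphere (0 : Space m) 1,
      omega (kappa a p h t) (lam (m + 1) p) (inner ℝ (σ : Space m) (eLast m)) *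
        |inner ℝ (σ : Space m) (eLast m)| ^ weightExp (m + 1) p *
        |inner ℝ (σ : Space m) z| ^ conj p
      ∂(MeasureTheory.volume : MeasureTheory.Measure (Space m)).toSphere) ^ (1 - recip p)

/-- The area of the unit sphere in `ℝ^k`. -/
def sphereArea (k : ℕ) : ℝ :=
  (MeasureTheory.volume : MeasureTheory.Measure (EuclideanSpace ℝ (Fin k))).toSphere.real Set.univ

/-- The explicit value of `W_p (x, t)` for `2 ≤ p ≤ ∞`, where `h` stands for `x_n`. -/
def explicitCoeff (n : ℕ) (a : ℝ) (p : ℝ≥0∞) (h t : ℝ) : ℝ :=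
  prefactor n a p h *
    (2 * sphereArea (n - 1) *
      ∫ θ in (0 : ℝ)..(Real.pi / 2),
        (∫ ξ in Set.Ioi (conj p * h ^ 2 / (4 * a ^ 2 * t * Real.cos θ ^ 2)),
            ξ ^ lam n p * Real.exp (-ξ)) *
          Real.cos θ ^ cosExp n p * Real.sin θ ^ (n - 2)) ^ (1 - recip p)

/-- The explicit value of `W_∞ (x, t)`, where `h` stands for `x_n`. -/
def explicitCoeffTop (n : ℕ) (a h t : ℝ) : ℝ :=
  4 / (Real.sqrt Real.pi * Real.Gamma (((n : ℝ) - 1) / 2) * h ^ 2) *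
    ∫ θ in (0 : ℝ)..(Real.pi / 2),
      (∫ ξ in Set.Ioi (h ^ 2 / (4 * a ^ 2 * t * Real.cos θ ^ 2)),
          ξ ^ ((n : ℝ) / 2) * Real.exp (-ξ)) *
        Real.cos θ ^ 2 * Real.sin θ ^ (n - 2)

end HeatDirichlet

end

/-! ### Behaviour of `L^r` norms as `r → ∞` -/

section LpLimits

open MeasureTheory Filter

variable {α E : Type*} [MeasurableSpace α] {μ : Measure α} [NormedAddCommGroup E]

/-! Differentiation under the integral gives `∇(u/x_n) = -C ∫ f K`, where `K =
e^{-|x-y|²/(4a²(t-τ))} (t-τ)^{-(n+4)/2} (x-y)` (`hasGradientAt_potential_div`). Since `x_n > 0`, `K`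
lies in every `L^q` of the layer (`memLp_domKernel`). Testing the vector integral against unit
vectors `z` and using Hölder's inequality, the sharp constant is `C` times the largest `‖(K, z)‖_q`.

These norms become sphere integrals (`lintegral_gradKernel_rpow`). The substitution `ξ = β/(t-τ)`
turns the time integral into an incomplete Gamma function. Central projection from `x` turns the
boundary hyperplane into directions `σ`, with `|x-y| = x_n/|σ_n|`. What remains is a multiple of `∫
W(|(σ,e_n)|) |(σ,z)|^q dσ` with `W` increasing.

The extremal direction comes from symmetry: the reflection exchanging `e_n` and `z` preserves
surface measure, and after averaging over it the two-term rearrangement inequality gives `z = e_n`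
(`lintegral_toSphere_mul_le`). This works for every `1 < p ≤ ∞`. Because `(K, e_n) > 0`, sharpness
needs the converse of Hölder only for nonnegative functions (`isLeast_admissible`). The endpoint `p
= 1`, where `q = ∞`, follows from `‖·‖_r → ‖·‖_∞` (`tendsto_eLpNorm_exponent_top`). The explicit
formula is the sphere integral at `z = e_n` in the polar angle. -/

theorem eLpNorm_le_eLpNorm_one_mul_eLpNorm_top {f : α → E} (hf : AEStronglyMeasurable f μ)
    {r : ℝ≥0∞} (h1 : 1 ≤ r) (hr : r ≠ ∞) :
    eLpNorm f r μ ≤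
      eLpNorm f 1 μ ^ (1 / r.toReal) * eLpNorm f ∞ μ ^ (1 - 1 / r.toReal) := by
  have hr1 : 1 ≤ r.toReal := by
    rw [← ENNReal.toReal_one]; exact ENNReal.toReal_mono hr h1
  have hr0 : 0 < r.toReal := by linarith
  rw [eLpNorm_eq_lintegral_rpow_enorm_toReal (zero_lt_one.trans_le h1).ne' hr]
  have key : ∫⁻ x, ‖f x‖ₑ ^ r.toReal ∂μ ≤ eLpNorm f 1 μ * eLpNorm f ∞ μ ^ (r.toReal - 1) := by
    rw [eLpNorm_one_eq_lintegral_enorm, ← lintegral_mul_const'' _ hf.enorm]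
    refine lintegral_mono_ae ?_
    filter_upwards [ae_le_eLpNormEssSup (f := f) (μ := μ)] with x hx
    calc ‖f x‖ₑ ^ r.toReal = ‖f x‖ₑ ^ (1 + (r.toReal - 1)) := by ring_nf
      _ = ‖f x‖ₑ * ‖f x‖ₑ ^ (r.toReal - 1) := by
        rw [ENNReal.rpow_add_of_nonneg _ _ zero_le_one (by linarith), ENNReal.rpow_one]
      _ ≤ _ := by
        gcongr
        simpa using hx
  refine (ENNReal.rpow_le_rpow key (by positivity)).trans_eq ?_
  rw [ENNReal.mul_rpow_of_nonneg _ _ (by positivity), ← ENNReal.rpow_mul]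
  congr 2
  field_simp

theorem MeasureTheory.MemLp.of_one_of_top {f : α → E} (h1 : MemLp f 1 μ) (h2 : MemLp f ∞ μ)
    {r : ℝ≥0∞} (hr : 1 ≤ r) : MemLp f r μ := by
  by_cases h : r = ∞
  · rwa [h]
  refine ⟨h1.1, (eLpNorm_le_eLpNorm_one_mul_eLpNorm_top h1.1 hr h).trans_lt ?_⟩
  have hr1 : 1 ≤ r.toReal := by
    rw [← ENNReal.toReal_one]; exact ENNReal.toReal_mono h hr
  refine ENNReal.mul_lt_top (ENNReal.rpow_lt_top_of_nonneg (by positivity) h1.2.ne)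
    (ENNReal.rpow_lt_top_of_nonneg ?_ h2.2.ne)
  rw [sub_nonneg, div_le_one (by linarith)]
  exact hr1

theorem ENNReal.tendsto_const_rpow {β : Type*} {l : Filter β} {c : ℝ≥0∞} (h0 : c ≠ 0)
    (ht : c ≠ ∞) {u : β → ℝ} {y : ℝ} (hu : Tendsto u l (𝓝 y)) :
    Tendsto (fun b => c ^ u b) l (𝓝 (c ^ y)) := by
  have hc : 0 < c.toReal := ENNReal.toReal_pos h0 ht
  have h : ∀ s : ℝ, c ^ s = ENNReal.ofReal (c.toReal ^ s) := fun s => by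
    rw [← ENNReal.ofReal_rpow_of_pos hc, ENNReal.ofReal_toReal ht]
  simp only [h]
  exact (ENNReal.continuous_ofReal.tendsto _).comp
    (((Real.continuous_const_rpow hc.ne').tendsto y).comp hu)

theorem tendsto_one_div_toReal_nhdsNE_top :
    Tendsto (fun r : ℝ≥0∞ => 1 / r.toReal) (𝓝[≠] ∞) (𝓝 0) := by
  have h : Tendsto (fun r : ℝ≥0∞ => (r⁻¹).toReal) (𝓝 ∞) (𝓝 (∞⁻¹ : ℝ≥0∞).toReal) :=
    (ENNReal.tendsto_toReal (by simp)).comp (continuous_inv.tendsto _)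
  refine (h.mono_left nhdsWithin_le_nhds).congr' ?_ |>.trans (by simp)
  exact Eventually.of_forall fun r => by simp

/-- Interpolation between `L^1` and `L^∞` bounds the norm from above. From below, Chebyshev gives `c
μ{|f| ≥ c}^{1/r}` for each `c` under the essential supremum; that set has positive measure by the
choice of `c`, and finite measure because `f ∈ L^1`. -/
theorem tendsto_eLpNorm_exponent_top {f : α → E} (h1 : MemLp f 1 μ) (h2 : MemLp f ∞ μ) :
    Tendsto (fun r : ℝ≥0∞ => eLpNorm f r μ) (𝓝[≠] ∞) (𝓝 (eLpNorm f ∞ μ)) := by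
  have hge : ∀ᶠ r : ℝ≥0∞ in 𝓝[≠] ∞, 1 ≤ r ∧ r ≠ ∞ :=
    ((eventually_gt_nhds (by simp : (1 : ℝ≥0∞) < ∞)).filter_mono nhdsWithin_le_nhds).mono
      (fun r hr => hr.le) |>.and eventually_mem_nhdsWithin
  by_cases hN : eLpNorm f 1 μ = 0
  · have hf : f =ᵐ[μ] 0 := (eLpNorm_eq_zero_iff h1.1 one_ne_zero).1 hN
    simp only [eLpNorm_congr_ae hf, eLpNorm_zero]
    exact tendsto_const_nhds
  have hM : eLpNorm f ∞ μ ≠ 0 := fun h =>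
    hN ((eLpNorm_eq_zero_iff h1.1 one_ne_zero).2
      ((eLpNorm_eq_zero_iff h1.1 ENNReal.top_ne_zero).1 h))
  refine tendsto_order.2 ⟨fun b hb => ?_, fun b hb => ?_⟩
  · obtain ⟨c, hbc, hcM⟩ := exists_between hb
    have hc0 : c ≠ 0 := (zero_le.trans_lt hbc).ne'
    have hct : c ≠ ∞ := (hcM.trans_le le_top).ne
    set A := μ {x | c ≤ ‖f x‖ₑ} with hA
    have hA0 : A ≠ 0 := fun h => by
      refine absurd hcM (not_lt.2 ?_)
      rw [eLpNorm_exponent_top]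
      refine essSup_le_of_ae_le c ?_
      have : ∀ᵐ x ∂μ, ¬ c ≤ ‖f x‖ₑ := by
        rw [ae_iff]; simpa [hA] using h
      filter_upwards [this] with x hx using (not_le.1 hx).le
    have hAt : A ≠ ∞ := by
      have := mul_meas_ge_le_lintegral₀ h1.1.enorm c
      rw [← eLpNorm_one_eq_lintegral_enorm] at this
      intro h
      rw [← hA, h, ENNReal.mul_top hc0] at this
      exact absurd h1.2 (by simpa using this)
    have hlim : Tendsto (fun r : ℝ≥0∞ => c * A ^ (1 / r.toReal)) (𝓝[≠] ∞) (𝓝 (c * A ^ (0 : ℝ))) :=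
      ENNReal.Tendsto.const_mul
        (ENNReal.tendsto_const_rpow hA0 hAt tendsto_one_div_toReal_nhdsNE_top) (Or.inr hct)
    rw [ENNReal.rpow_zero, mul_one] at hlim
    filter_upwards [hge, hlim.eventually_const_lt hbc] with r ⟨hr1, hrt⟩ hr
    refine hr.trans_le ?_
    have hr0 : 0 < r.toReal := ENNReal.toReal_pos (zero_lt_one.trans_le hr1).ne' hrt
    have := pow_mul_meas_ge_le_eLpNorm μ (zero_lt_one.trans_le hr1).ne' hrt h1.1 (c ^ r.toReal)
    simp only [ENNReal.rpow_le_rpow_iff hr0] at this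
    rw [← hA, ENNReal.mul_rpow_of_nonneg _ _ (by positivity), ← ENNReal.rpow_mul,
      mul_one_div_cancel hr0.ne', ENNReal.rpow_one] at this
    exact this
  · have hlim : Tendsto (fun r : ℝ≥0∞ => eLpNorm f 1 μ ^ (1 / r.toReal) *
        eLpNorm f ∞ μ ^ (1 - 1 / r.toReal)) (𝓝[≠] ∞)
        (𝓝 (eLpNorm f 1 μ ^ (0 : ℝ) * eLpNorm f ∞ μ ^ (1 - 0 : ℝ))) := by
      refine ENNReal.Tendsto.mul
        (ENNReal.tendsto_const_rpow hN h1.2.ne tendsto_one_div_toReal_nhdsNE_top) (Or.inl (by simp))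
        (ENNReal.tendsto_const_rpow hM h2.2.ne
          (tendsto_const_nhds.sub tendsto_one_div_toReal_nhdsNE_top)) (Or.inr (by simp))
    rw [ENNReal.rpow_zero, one_mul, sub_zero, ENNReal.rpow_one] at hlim
    filter_upwards [hge, hlim.eventually_lt_const hb] with r ⟨hr1, hrt⟩ hr
    exact (eLpNorm_le_eLpNorm_one_mul_eLpNorm_top h1.1 hr1 hrt).trans_lt hr

end LpLimits

/-! ### Hölder's inequality and its converse for a nonnegative function -/

section Duality

open MeasureTheory Filter

variable {α : Type*} [MeasurableSpace α] {μ : Measure α}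

theorem abs_integral_mul_le_eLpNorm {f g : α → ℝ} {p q : ℝ≥0∞} [p.HolderConjugate q]
    (hf : MemLp f p μ) (hg : MemLp g q μ) :
    |∫ x, f x * g x ∂μ| ≤ (eLpNorm g q μ).toReal * (eLpNorm f p μ).toReal := by
  have h := eLpNorm_smul_le_mul_eLpNorm (p := p) (q := q) (r := 1) hg.1 hf.1
  have h1 : ‖∫ x, f x * g x ∂μ‖ₑ ≤ eLpNorm f p μ * eLpNorm g q μ :=
    (enorm_integral_le_lintegral_enorm _).trans (by
      rw [eLpNorm_one_eq_lintegral_enorm] at h; exact h)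
  rw [mul_comm, ← ENNReal.toReal_mul, ← Real.norm_eq_abs, ← toReal_enorm]
  exact ENNReal.toReal_mono (ENNReal.mul_lt_top hf.2 hg.2).ne h1

/-- The extremal density is `g^{q-1}` for `q < ∞`; for `q = ∞` one uses indicators of superlevel
sets. Integrability of `g` makes those sets finite in measure, so no σ-finiteness is needed. -/
theorem toReal_eLpNorm_le_of_forall_integral_mul_le {g : α → ℝ} (hg : ∀ x, 0 ≤ g x)
    (hgm : Measurable g) (hg0 : ¬ g =ᵐ[μ] 0) (h1 : MemLp g 1 μ) (ht : MemLp g ∞ μ)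
    {p q : ℝ≥0∞} [p.HolderConjugate q] {C : ℝ}
    (hC : ∀ f : α → ℝ, Measurable f → MemLp f p μ →
      |∫ x, f x * g x ∂μ| ≤ C * (eLpNorm f p μ).toReal) :
    (eLpNorm g q μ).toReal ≤ C := by
  have hp1 : 1 ≤ p := ENNReal.HolderConjugate.one_le p q
  have hq1 : 1 ≤ q := ENNReal.HolderConjugate.one_le q p
  have hpos : ∀ r : ℝ≥0∞, 1 ≤ r → 0 < (eLpNorm g r μ).toReal := fun r hr =>
    ENNReal.toReal_pos
      (fun h => hg0 ((eLpNorm_eq_zero_iff h1.1 (zero_lt_one.trans_le hr).ne').1 h))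
      (h1.of_one_of_top ht hr).2.ne
  -- Test the inequality on `g` itself.
  have hC0 : 0 ≤ C :=
    nonneg_of_mul_nonneg_left ((abs_nonneg _).trans (hC g hgm (h1.of_one_of_top ht hp1)))
      (hpos p hp1)
  by_cases hq : q = ∞
  · subst hq
    have hp : p = 1 := (ENNReal.HolderConjugate.eq_top_iff_eq_one ∞ p).1 rfl
    subst hp
    by_contra! hlt
    obtain ⟨c, hCc, hcM⟩ := exists_between hlt
    have hc0 : 0 < c := hC0.trans_lt hCc
    set A := {x | c ≤ g x} with hA
    have hAm : MeasurableSet A := measurableSet_le measurable_const hgm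
    have hA0 : μ A ≠ 0 := fun h => by
      refine absurd hcM (not_lt.2 ?_)
      refine ENNReal.toReal_le_of_le_ofReal hc0.le ?_
      rw [eLpNorm_exponent_top]
      refine essSup_le_of_ae_le _ ?_
      have : ∀ᵐ x ∂μ, ¬ c ≤ g x := by
        rw [ae_iff]; simpa [hA] using h
      filter_upwards [this] with x hx
      rw [Real.enorm_eq_ofReal (hg x)]
      exact ENNReal.ofReal_le_ofReal (not_le.1 hx).le
    have hAt : μ A < ∞ := by
      have := mul_meas_ge_le_lintegral₀ h1.1.enorm (ENNReal.ofReal c)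
      rw [← eLpNorm_one_eq_lintegral_enorm] at this
      have hA' : {x | ENNReal.ofReal c ≤ ‖g x‖ₑ} = A := by
        ext x
        simp only [Set.mem_ofPred_eq, hA]
        rw [Real.enorm_eq_ofReal (hg x), ENNReal.ofReal_le_ofReal_iff (hg x)]
      rw [hA'] at this
      refine lt_top_iff_ne_top.2 fun h => ?_
      rw [h, ENNReal.mul_top (by simpa using hc0)] at this
      exact absurd h1.2 (by simpa using this)
    have hf : MemLp (A.indicator fun _ => (1 : ℝ)) 1 μ :=
      memLp_indicator_const 1 hAm 1 (Or.inr hAt.ne)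
    have h := hC _ (measurable_const.indicator hAm) hf
    have hnorm : (eLpNorm (A.indicator fun _ => (1 : ℝ)) 1 μ).toReal = μ.real A := by
      rw [eLpNorm_indicator_const hAm one_ne_zero ENNReal.one_ne_top]
      simp [Measure.real]
    have hint : ∫ x, A.indicator (fun _ => (1 : ℝ)) x * g x ∂μ = ∫ x in A, g x ∂μ := by
      rw [← integral_indicator hAm]
      refine integral_congr_ae (Eventually.of_forall fun x => ?_)
      by_cases hx : x ∈ A <;> simp [hx]
    have hlow : c * μ.real A ≤ ∫ x in A, g x ∂μ := by
      have h := setIntegral_mono_on (μ := μ) (s := A) (f := fun _ => c) (g := g)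
        (integrableOn_const hAt.ne) (memLp_one_iff_integrable.1 h1).integrableOn hAm
        (fun x hx => hx)
      rwa [setIntegral_const, smul_eq_mul, mul_comm] at h
    rw [hnorm, hint] at h
    have hAr : 0 < μ.real A := ENNReal.toReal_pos hA0 hAt.ne
    have := (hlow.trans (le_abs_self _)).trans h
    exact absurd (le_of_mul_le_mul_right this hAr) (not_le.2 hCc)
  · have hqr : 1 ≤ q.toReal := by
      rw [← ENNReal.toReal_one]; exact ENNReal.toReal_mono hq hq1
    have hgq := h1.of_one_of_top ht hq1
    set N := (eLpNorm g q μ).toReal with hN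
    have hN0 : 0 < N := hpos q hq1
    have hint : ∫ x, g x ^ (q.toReal - 1) * g x ∂μ = N ^ q.toReal := by
      have h := hgq.eLpNorm_eq_integral_rpow_norm (zero_lt_one.trans_le hq1).ne' hq
      have hI : 0 ≤ ∫ x, ‖g x‖ ^ q.toReal ∂μ := integral_nonneg fun x => by positivity
      rw [hN, h, ENNReal.toReal_ofReal (by positivity), ← Real.rpow_mul hI,
        inv_mul_cancel₀ (by linarith), Real.rpow_one]
      refine integral_congr_ae (Eventually.of_forall fun x => ?_)
      simp only [Real.norm_eq_abs, abs_of_nonneg (hg x)]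
      rcases (hg x).eq_or_lt with h0 | h0
      · rw [← h0, mul_zero, Real.zero_rpow (by linarith)]
      · rw [Real.rpow_sub_one h0.ne', div_mul_cancel₀ _ h0.ne']
    have hfm : Measurable fun x => g x ^ (q.toReal - 1) := hgm.pow_const _
    have hnorm : MemLp (fun x => g x ^ (q.toReal - 1)) p μ ∧
        (eLpNorm (fun x => g x ^ (q.toReal - 1)) p μ).toReal ≤ N ^ (q.toReal - 1) := by
      -- For `q = 1` the test function is the constant `1`, also where `g = 0`, since `0 ^ 0 = 1`.
      by_cases hp : p = ∞
      · have hq' : q = 1 := (ENNReal.HolderConjugate.eq_top_iff_eq_one p q).1 hp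
        subst hp hq'
        simp only [ENNReal.toReal_one, sub_self, Real.rpow_zero]
        refine ⟨memLp_top_const 1, ENNReal.toReal_le_of_le_ofReal zero_le_one ?_⟩
        rw [eLpNorm_exponent_top]
        refine essSup_le_of_ae_le _ (Eventually.of_forall fun x => by simp)
      · have hconj := ENNReal.HolderConjugate.toReal_of_ne_top hp hq
        have hq1' : 0 < q.toReal - 1 := by linarith [hconj.symm.lt]
        have he : p * ENNReal.ofReal (q.toReal - 1) = q := by
          rw [← ENNReal.ofReal_toReal hp, ← ENNReal.ofReal_mul ENNReal.toReal_nonneg,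
            mul_comm, hconj.symm.sub_one_mul_conj, ENNReal.ofReal_toReal hq]
        have hn := eLpNorm_norm_rpow (p := p) (μ := μ) g hq1'
        simp only [Real.norm_eq_abs, abs_of_nonneg (hg _)] at hn
        rw [he] at hn
        refine ⟨⟨hfm.aestronglyMeasurable, ?_⟩, ?_⟩
        · rw [hn]; exact ENNReal.rpow_lt_top_of_nonneg hq1'.le hgq.2.ne
        · rw [hn, ENNReal.toReal_rpow]
    have h := (le_abs_self _).trans (hC _ hfm hnorm.1)
    rw [hint] at h
    have h2 := h.trans (mul_le_mul_of_nonneg_left hnorm.2 hC0)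
    rw [Real.rpow_sub_one hN0.ne'] at h2
    have h3 : 0 < N ^ q.toReal := by positivity
    rw [← mul_div_assoc, le_div_iff₀ hN0, mul_comm] at h2
    exact le_of_mul_le_mul_right h2 h3

end Duality

/-! ### The gradient kernel: integrability and differentiation under the integral -/

noncomputable section

namespace HeatDirichlet

open MeasureTheory Filter

variable {m : ℕ}

/-- The tangential part `x'` of `x = (x', x_n)`. -/
def tangential (x : Space m) : Bdry m := WithLp.toLp 2 fun i => x i.castSucc

theorem bdryPoint_castSucc (y : Bdry m) (i : Fin m) : bdryPoint y i.castSucc = y i := by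
  simp [bdryPoint]

theorem bdryPoint_last (y : Bdry m) : bdryPoint y (Fin.last m) = 0 := by
  simp [bdryPoint]

theorem inner_eLast (x : Space m) : inner ℝ x (eLast m) = x (Fin.last m) := by
  simp [eLast, EuclideanSpace.inner_single_right]

theorem norm_eLast : ‖eLast m‖ = 1 := by simp [eLast]

theorem norm_sq_eq_tangential (x : Space m) :
    ‖x‖ ^ 2 = ‖tangential x‖ ^ 2 + x (Fin.last m) ^ 2 := by
  rw [EuclideanSpace.norm_sq_eq, EuclideanSpace.norm_sq_eq, Fin.sum_univ_castSucc]
  simp [tangential]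

theorem tangential_sub_bdryPoint (x : Space m) (y : Bdry m) :
    tangential (x - bdryPoint y) = tangential x - y := by
  ext i
  simp [tangential, bdryPoint_castSucc]

theorem sub_bdryPoint_last (x : Space m) (y : Bdry m) :
    (x - bdryPoint y) (Fin.last m) = x (Fin.last m) := by
  simp [bdryPoint_last]

theorem norm_sub_bdryPoint_sq (x : Space m) (y : Bdry m) :
    ‖x - bdryPoint y‖ ^ 2 = ‖tangential x - y‖ ^ 2 + x (Fin.last m) ^ 2 := by
  rw [norm_sq_eq_tangential, tangential_sub_bdryPoint, sub_bdryPoint_last]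

theorem last_le_norm_sub_bdryPoint (x : Space m) (y : Bdry m) :
    x (Fin.last m) ≤ ‖x - bdryPoint y‖ := by
  refine le_of_sq_le_sq ?_ (norm_nonneg _)
  rw [norm_sub_bdryPoint_sq]
  nlinarith [sq_nonneg ‖tangential x - y‖]

theorem norm_tangential_sub_le (x : Space m) (y : Bdry m) :
    ‖tangential x - y‖ ≤ ‖x - bdryPoint y‖ := by
  refine le_of_sq_le_sq ?_ (norm_nonneg _)
  rw [norm_sub_bdryPoint_sq]
  nlinarith [sq_nonneg (x (Fin.last m))]

@[fun_prop]
theorem continuous_bdryPoint : Continuous (bdryPoint : Bdry m → Space m) := by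
  refine (PiLp.continuous_toLp 2 _).comp (continuous_pi fun i => ?_)
  refine Fin.lastCases ?_ (fun j => ?_) i
  · simp only [Fin.snoc_last]; fun_prop
  · simp only [Fin.snoc_castSucc]; fun_prop

@[fun_prop]
theorem measurable_bdryPoint : Measurable (bdryPoint : Bdry m → Space m) :=
  continuous_bdryPoint.measurable

theorem measurableSet_layer (t : ℝ) : MeasurableSet (layer m t) :=
  MeasurableSet.univ.prod measurableSet_Ioo

theorem mem_layer {t : ℝ} {w : Bdry m × ℝ} : w ∈ layer m t ↔ 0 < w.2 ∧ w.2 < t := by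
  simp [layer]

/-- The modulus of the vector kernel of `∇ (u / x_n)`, with a general decay rate `b`. -/
def domKernel (b t : ℝ) (x : Space m) (w : Bdry m × ℝ) : ℝ :=
  ‖x - bdryPoint w.1‖ * Real.exp (-(b * ‖x - bdryPoint w.1‖ ^ 2 / (t - w.2))) /
    (t - w.2) ^ ((((m + 1 : ℕ) : ℝ) + 4) / 2)

@[fun_prop]
theorem measurable_domKernel (b t : ℝ) (x : Space m) : Measurable (domKernel b t x) := by
  unfold domKernel
  fun_prop

theorem domKernel_nonneg {b t : ℝ} {x : Space m} {w : Bdry m × ℝ} (hw : w ∈ layer m t) :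
    0 ≤ domKernel b t x w := by
  have : 0 < t - w.2 := sub_pos.2 (mem_layer.1 hw).2
  unfold domKernel
  positivity

/-- The Gaussian beats any power of `R²/(t-τ)`, where `R = |x-y| ≥ x_n`, so it absorbs the
singularity at `τ = t` and still leaves integrable decay in `y`. One bound thus serves both `L^1`
and `L^∞`. -/
theorem domKernel_le {b t : ℝ} (hb : 0 < b) {x : Space m} (hx : 0 < x (Fin.last m)) :
    ∃ C : ℝ, 0 ≤ C ∧ ∀ w ∈ layer m t,
      domKernel b t x w ≤ C * (1 + ‖tangential x - w.1‖) ^ (-((m : ℝ) + 1)) := by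
  set h := x (Fin.last m) with hh
  set r : ℝ := (((m + 1 : ℕ) : ℝ) + 4) / 2 with hr
  -- `c` is chosen so that `R ≥ h` and `R ≥ ρ` together give `c(1+ρ) ≤ R`.
  set c := h / (1 + h) with hc
  have hc0 : 0 < c := by positivity
  refine ⟨(m + 5).factorial * |t| ^ r / (b ^ (m + 5) * c ^ (m + 1) * h ^ (m + 8)), by positivity,
    fun w hw => ?_⟩
  obtain ⟨hw0, hwt⟩ := mem_layer.1 hw
  have hs : 0 < t - w.2 := sub_pos.2 hwt
  have ht : 0 < t := hw0.trans hwt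
  have hst : t - w.2 ≤ t := by linarith
  set s := t - w.2 with hsdef
  set R := ‖x - bdryPoint w.1‖ with hR
  set ρ := ‖tangential x - w.1‖ with hρ
  have hρ0 : 0 ≤ ρ := norm_nonneg _
  have hhR : h ≤ R := last_le_norm_sub_bdryPoint _ _
  have hρR : ρ ≤ R := norm_tangential_sub_le _ _
  have hR0 : 0 < R := hx.trans_le hhR
  have hcR : c * (1 + ρ) ≤ R := by
    rw [hc, div_mul_eq_mul_div, div_le_iff₀ (by positivity)]
    nlinarith
  -- The power `m + 5 = 2r` leaves `s^r ≤ t^r` in the numerator and `R^{2m+9}` in the denominator.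
  -- Of the latter, `m + 1` factors supply decay in `ρ` and `m + 8` are bounded below by `h`.
  have hexp : Real.exp (-(b * R ^ 2 / s)) ≤ (m + 5).factorial / (b * R ^ 2 / s) ^ (m + 5) := by
    have := Real.pow_div_factorial_le_exp (b * R ^ 2 / s) (by positivity) (m + 5)
    rw [Real.exp_neg, ← one_div, div_le_div_iff₀ (Real.exp_pos _) (by positivity), one_mul]
    rwa [div_le_iff₀' (by positivity)] at this
  have hsr : s ^ (m + 5) = s ^ r * s ^ r := by
    rw [← Real.rpow_add hs, ← Real.rpow_natCast]
    congr 1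
    rw [hr]
    push_cast
    ring
  have hsr0 : 0 < s ^ r := Real.rpow_pos_of_pos hs r
  have hrpow : (1 + ρ) ^ (-((m : ℝ) + 1)) = ((1 + ρ) ^ (m + 1))⁻¹ := by
    rw [Real.rpow_neg (by positivity), ← Real.rpow_natCast]
    push_cast
    rfl
  calc domKernel b t x w = R * Real.exp (-(b * R ^ 2 / s)) / s ^ r := rfl
    _ ≤ R * ((m + 5).factorial / (b * R ^ 2 / s) ^ (m + 5)) / s ^ r := by gcongr
    _ = (m + 5).factorial * s ^ r / (b ^ (m + 5) * R ^ (m + 1) * R ^ (m + 8)) := by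
      rw [div_pow, hsr, mul_pow]
      field_simp
      ring
    _ ≤ (m + 5).factorial * |t| ^ r / (b ^ (m + 5) * (c * (1 + ρ)) ^ (m + 1) * h ^ (m + 8)) := by
      rw [abs_of_pos ht]
      gcongr
    _ = _ := by
      rw [hrpow, mul_pow]
      field_simp

theorem volume_restrict_layer (t : ℝ) :
    (volume : Measure (Bdry m × ℝ)).restrict (layer m t) =
      (volume : Measure (Bdry m)).prod (volume.restrict (Set.Ioo (0 : ℝ) t)) := by
  rw [layer, Measure.volume_eq_prod, ← Measure.prod_restrict, Measure.restrict_univ]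

theorem memLp_domKernel {b t : ℝ} (hb : 0 < b) {x : Space m} (hx : 0 < x (Fin.last m))
    {q : ℝ≥0∞} (hq : 1 ≤ q) : MemLp (domKernel b t x) q (volume.restrict (layer m t)) := by
  obtain ⟨C, hC0, hC⟩ := domKernel_le (t := t) hb hx
  have hm : AEStronglyMeasurable (domKernel b t x) (volume.restrict (layer m t)) :=
    (measurable_domKernel b t x).aestronglyMeasurable
  refine MemLp.of_one_of_top (memLp_one_iff_integrable.2 ?_) (memLp_top_of_bound hm C ?_) hq
  · have hint : Integrable (fun y : Bdry m => C * (1 + ‖tangential x - y‖) ^ (-((m : ℝ) + 1))) := by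
      refine Integrable.const_mul ?_ C
      exact (integrable_one_add_norm (E := Bdry m) (μ := volume) (r := (m : ℝ) + 1)
        (by simp)).comp_sub_left (tangential x)
    have hint' : Integrable (fun w : Bdry m × ℝ =>
        C * (1 + ‖tangential x - w.1‖) ^ (-((m : ℝ) + 1))) (volume.restrict (layer m t)) := by
      rw [volume_restrict_layer]
      exact hint.comp_fst _
    refine hint'.mono' hm ?_
    filter_upwards [ae_restrict_mem (measurableSet_layer t)] with w hw
    rw [Real.norm_of_nonneg (domKernel_nonneg hw)]
    exact hC w hw
  · filter_upwards [ae_restrict_mem (measurableSet_layer t)] with w hw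
    rw [Real.norm_of_nonneg (domKernel_nonneg hw)]
    refine (hC w hw).trans (mul_le_of_le_one_right hC0 ?_)
    exact Real.rpow_le_one_of_one_le_of_nonpos (by linarith [norm_nonneg (tangential x - w.1)])
      (by have : (0 : ℝ) ≤ m := by positivity
          linarith)

/-- The vector kernel of `∇ (u / x_n)`, up to a constant factor. -/
def gradKernel (a t : ℝ) (x : Space m) (w : Bdry m × ℝ) : Space m :=
  (Real.exp (-(‖x - bdryPoint w.1‖ ^ 2 / (4 * a ^ 2 * (t - w.2)))) /
    (t - w.2) ^ ((((m + 1 : ℕ) : ℝ) + 4) / 2)) • (x - bdryPoint w.1)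

@[fun_prop]
theorem measurable_gradKernel (a t : ℝ) (x : Space m) : Measurable (gradKernel a t x) := by
  unfold gradKernel
  fun_prop

theorem norm_gradKernel {a t : ℝ} {x : Space m} {w : Bdry m × ℝ} (hw : w ∈ layer m t) :
    ‖gradKernel a t x w‖ = domKernel (1 / (4 * a ^ 2)) t x w := by
  have hs : 0 < t - w.2 := sub_pos.2 (mem_layer.1 hw).2
  unfold gradKernel domKernel
  rw [norm_smul, Real.norm_of_nonneg (by positivity)]
  have : 1 / (4 * a ^ 2) * ‖x - bdryPoint w.1‖ ^ 2 / (t - w.2) =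
      ‖x - bdryPoint w.1‖ ^ 2 / (4 * a ^ 2 * (t - w.2)) := by
    rw [one_div_mul_eq_div, div_div]
  rw [this]
  ring

theorem memLp_gradKernel {a t : ℝ} (ha : a ≠ 0) {x : Space m} (hx : 0 < x (Fin.last m))
    {q : ℝ≥0∞} (hq : 1 ≤ q) : MemLp (gradKernel a t x) q (volume.restrict (layer m t)) := by
  refine (memLp_domKernel (b := 1 / (4 * a ^ 2)) (by positivity) hx hq).mono
    (measurable_gradKernel a t x).aestronglyMeasurable ?_
  filter_upwards [ae_restrict_mem (measurableSet_layer t)] with w hw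
  rw [norm_gradKernel hw]
  exact le_abs_self _

/-- Domination uniform in `ξ` near `x`: moving by less than `x_n/2 ≤ |x-y|/2` keeps `|ξ-y|` between
`1/2` and `3/2` of `|x-y|`, and halving the distance divides the Gaussian rate by four. -/
theorem norm_gradKernel_le_of_mem_ball {a t : ℝ} {x ξ : Space m}
    (hξ : ξ ∈ Metric.ball x (x (Fin.last m) / 2)) {w : Bdry m × ℝ} (hw : w ∈ layer m t) :
    ‖gradKernel a t ξ w‖ ≤ 3 / 2 * domKernel (1 / (16 * a ^ 2)) t x w := by
  have hs : 0 < t - w.2 := sub_pos.2 (mem_layer.1 hw).2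
  rw [norm_gradKernel hw]
  unfold domKernel
  have hR := last_le_norm_sub_bdryPoint x w.1
  have hd : ‖ξ - x‖ < x (Fin.last m) / 2 := by rwa [Metric.mem_ball, dist_eq_norm] at hξ
  have h1 : ‖ξ - bdryPoint w.1‖ ≤ 3 / 2 * ‖x - bdryPoint w.1‖ := by
    have : ξ - bdryPoint w.1 = (ξ - x) + (x - bdryPoint w.1) := by abel
    rw [this]
    refine (norm_add_le _ _).trans ?_
    linarith
  have h2 : ‖x - bdryPoint w.1‖ / 2 ≤ ‖ξ - bdryPoint w.1‖ := by
    have he : x - bdryPoint w.1 = (ξ - bdryPoint w.1) - (ξ - x) := by abel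
    have := norm_sub_le (ξ - bdryPoint w.1) (ξ - x)
    rw [← he] at this
    linarith
  rw [← mul_div_assoc, ← mul_assoc]
  gcongr ?_ * Real.exp (-?_) / _
  calc 1 / (16 * a ^ 2) * ‖x - bdryPoint w.1‖ ^ 2 / (t - w.2)
      = 1 / (4 * a ^ 2) * (‖x - bdryPoint w.1‖ / 2) ^ 2 / (t - w.2) := by ring
    _ ≤ _ := by gcongr

theorem IsData.memLp_layer {p : ℝ≥0∞} {f : Bdry m × ℝ → ℝ} (hf : IsData p f) (t : ℝ) :
    MemLp f p (volume.restrict (layer m t)) :=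
  hf.mono_measure (Measure.restrict_mono
    (Set.prod_mono_right fun _ h => h.1) le_rfl)

theorem abs_potentialIntegrand_le {a t : ℝ} {f : Bdry m × ℝ → ℝ} {x : Space m}
    (hx : 0 < x (Fin.last m)) {w : Bdry m × ℝ} (hw : w ∈ layer m t) :
    |potentialIntegrand a f x t w| ≤
      t / x (Fin.last m) * |f w * domKernel (1 / (4 * a ^ 2)) t x w| := by
  obtain ⟨hw0, hwt⟩ := mem_layer.1 hw
  have hs : 0 < t - w.2 := sub_pos.2 hwt
  have hR := last_le_norm_sub_bdryPoint x w.1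
  have hR0 := hx.trans_le hR
  rw [abs_mul (f w), abs_of_nonneg (domKernel_nonneg hw), ← norm_gradKernel hw]
  unfold potentialIntegrand gradKernel
  rw [norm_smul, abs_mul, Real.norm_of_nonneg (by positivity), abs_of_nonneg (by positivity)]
  have he : (t - w.2) ^ ((((m + 1 : ℕ) : ℝ) + 4) / 2) =
      (t - w.2) ^ ((((m + 1 : ℕ) : ℝ) + 2) / 2) * (t - w.2) := by
    rw [← Real.rpow_add_one hs.ne']
    congr 1
    ring
  rw [he]
  set E := Real.exp (-(‖x - bdryPoint w.1‖ ^ 2 / (4 * a ^ 2 * (t - w.2))))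
  set S := (t - w.2) ^ ((((m + 1 : ℕ) : ℝ) + 2) / 2)
  have hS : 0 < S := Real.rpow_pos_of_pos hs _
  -- Both factors are at least one; they convert the potential kernel into the gradient kernel,
  -- whose integrability is already known.
  have h1 : 1 ≤ t / (t - w.2) * (‖x - bdryPoint w.1‖ / x (Fin.last m)) :=
    one_le_mul_of_one_le_of_one_le ((one_le_div hs).2 (by linarith)) ((one_le_div hx).2 hR)
  calc E / S * |f w| = E / S * |f w| * 1 := (mul_one _).symm
    _ ≤ E / S * |f w| * (t / (t - w.2) * (‖x - bdryPoint w.1‖ / x (Fin.last m))) := by gcongr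
    _ = _ := by field_simp

theorem measurable_heatFactor (a t : ℝ) (x : Space m) : Measurable fun w : Bdry m × ℝ =>
    Real.exp (-(‖x - bdryPoint w.1‖ ^ 2 / (4 * a ^ 2 * (t - w.2)))) /
      (t - w.2) ^ ((((m + 1 : ℕ) : ℝ) + 2) / 2) := by
  fun_prop

theorem integrableOn_potentialIntegrand {a t : ℝ} (ha : a ≠ 0) {p : ℝ≥0∞} (hp : 1 ≤ p)
    {f : Bdry m × ℝ → ℝ} (hf : IsData p f) {x : Space m} (hx : 0 < x (Fin.last m)) :
    IntegrableOn (potentialIntegrand a f x t) (layer m t) := by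
  have := ENNReal.HolderConjugate.conjExponent hp
  have hfl := hf.memLp_layer t
  have hd := memLp_domKernel (b := 1 / (4 * a ^ 2)) (t := t) (by positivity) hx
    (ENNReal.HolderConjugate.one_le p.conjExponent p)
  refine ((hfl.integrable_mul hd).abs.const_mul (t / x (Fin.last m))).mono'
    ((measurable_heatFactor a t x).aestronglyMeasurable.mul hfl.1) ?_
  filter_upwards [ae_restrict_mem (measurableSet_layer t)] with w hw
  exact abs_potentialIntegrand_le hx hw

theorem hasFDerivAt_potentialIntegrand (a : ℝ) {t : ℝ} (f : Bdry m × ℝ → ℝ)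
    {w : Bdry m × ℝ} (hw : w ∈ layer m t) (ξ : Space m) :
    HasFDerivAt (fun ξ => potentialIntegrand a f ξ t w)
      ((-(1 / (2 * a ^ 2))) • innerSL ℝ (f w • gradKernel a t ξ w)) ξ := by
  have hs : 0 < t - w.2 := sub_pos.2 (mem_layer.1 hw).2
  have h1 : HasFDerivAt (fun ξ : Space m => ‖ξ - bdryPoint w.1‖ ^ 2) _ ξ :=
    ((hasFDerivAt_id ξ).sub_const (bdryPoint w.1)).norm_sq
  have h2 := (((h1.mul_const (4 * a ^ 2 * (t - w.2))⁻¹).neg.exp).mul_const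
    ((t - w.2) ^ ((((m + 1 : ℕ) : ℝ) + 2) / 2))⁻¹).mul_const (f w)
  refine (h2.congr_of_eventuallyEq
    (Eventually.of_forall fun ζ => by simp [potentialIntegrand, div_eq_mul_inv])).congr_fderiv ?_
  have he : (t - w.2) ^ ((((m + 1 : ℕ) : ℝ) + 4) / 2) =
      (t - w.2) ^ ((((m + 1 : ℕ) : ℝ) + 2) / 2) * (t - w.2) := by
    rw [← Real.rpow_add_one hs.ne']
    congr 1
    ring
  have hS : 0 < (t - w.2) ^ ((((m + 1 : ℕ) : ℝ) + 2) / 2) := Real.rpow_pos_of_pos hs _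
  ext v
  by_cases ha : a = 0
  · simp [ha]
  rw [gradKernel, he]
  clear h2
  generalize (t - w.2) ^ ((((m + 1 : ℕ) : ℝ) + 2) / 2) = S at hS
  simp
  field_simp
  ring

/-- The constant in front of the integral representing `∇ (u / x_n)`. -/
def gradConst (n : ℕ) (a : ℝ) : ℝ :=
  1 / ((4 * a ^ 2 * Real.pi) ^ ((n : ℝ) / 2) * (2 * a ^ 2))

theorem integrable_smul_gradKernel {a t : ℝ} (ha : a ≠ 0) {p : ℝ≥0∞} (hp : 1 ≤ p)
    {f : Bdry m × ℝ → ℝ} (hf : MemLp f p (volume.restrict (layer m t)))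
    {x : Space m} (hx : 0 < x (Fin.last m)) :
    Integrable (fun w => f w • gradKernel a t x w) (volume.restrict (layer m t)) := by
  have := ENNReal.HolderConjugate.conjExponent hp
  have hd := memLp_gradKernel (t := t) ha hx (ENNReal.HolderConjugate.one_le p.conjExponent p)
  exact memLp_one_iff_integrable.1 (hd.smul hf)

theorem hasGradientAt_potential_div {a t : ℝ} (ha : a ≠ 0) {p : ℝ≥0∞} (hp : 1 ≤ p)
    {f : Bdry m × ℝ → ℝ} (hf : IsData p f) {x : Space m} (hx : 0 < x (Fin.last m)) :
    HasGradientAt (fun ξ : Space m => potential a f ξ t / ξ (Fin.last m))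
      (-(gradConst (m + 1) a) • ∫ w in layer m t, f w • gradKernel a t x w) x := by
  have := ENNReal.HolderConjugate.conjExponent hp
  have hfl := hf.memLp_layer t
  have hpos : ∀ᶠ ξ : Space m in 𝓝 x, 0 < ξ (Fin.last m) :=
    (EuclideanSpace.proj (𝕜 := ℝ) (Fin.last m)).continuous.continuousAt.eventually_const_lt hx
  have hd := memLp_domKernel (b := 1 / (16 * a ^ 2)) (t := t) (by positivity) hx
    (ENNReal.HolderConjugate.one_le p.conjExponent p)
  have hmain := hasFDerivAt_integral_of_dominated_of_fderiv_le
    (μ := volume.restrict (layer m t)) (𝕜 := ℝ)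
    (F := fun ξ w => potentialIntegrand a f ξ t w)
    (F' := fun ξ w => (-(1 / (2 * a ^ 2))) • innerSL ℝ (f w • gradKernel a t ξ w))
    (bound := fun w => 1 / (2 * a ^ 2) *
      (3 / 2 * |f w * domKernel (1 / (16 * a ^ 2)) t x w|))
    (Metric.ball_mem_nhds x (half_pos hx))
    (hpos.mono fun ξ hξ => (integrableOn_potentialIntegrand ha hp hf hξ).1)
    (integrableOn_potentialIntegrand ha hp hf hx)
    (by
      have h := ((innerSL ℝ (E := Space m)).continuous.comp_aestronglyMeasurable
        (integrable_smul_gradKernel ha hp hfl hx).1).const_smul (-(1 / (2 * a ^ 2)))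
      exact h)
    (by
      filter_upwards [ae_restrict_mem (measurableSet_layer t)] with w hw ξ hξ
      rw [norm_smul, innerSL_apply_norm, norm_smul, norm_neg, Real.norm_of_nonneg (by positivity),
        abs_mul, abs_of_nonneg (domKernel_nonneg hw), Real.norm_eq_abs]
      refine mul_le_mul_of_nonneg_left ?_ (by positivity)
      nlinarith [norm_gradKernel_le_of_mem_ball (a := a) hξ hw, abs_nonneg (f w)])
    (((hfl.integrable_mul hd).abs.const_mul _).const_mul _)
    (by
      filter_upwards [ae_restrict_mem (measurableSet_layer t)] with w hw ξ hξ
      exact hasFDerivAt_potentialIntegrand a f hw ξ)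
  have hint : ∫ w in layer m t, (-(1 / (2 * a ^ 2))) • innerSL ℝ (f w • gradKernel a t x w) =
      (-(1 / (2 * a ^ 2))) • innerSL ℝ (∫ w in layer m t, f w • gradKernel a t x w) := by
    rw [integral_smul, ContinuousLinearMap.integral_comp_comm (innerSL ℝ)
      (integrable_smul_gradKernel ha hp hfl hx)]
  rw [hint] at hmain
  have h2 := hmain.const_mul (1 / (4 * a ^ 2 * Real.pi) ^ (((m + 1 : ℕ) : ℝ) / 2))
  rw [hasGradientAt_iff_hasFDerivAt]
  refine (h2.congr_of_eventuallyEq ?_).congr_fderiv ?_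
  -- The factor `ξ_n` cancels only where it is nonzero, so the equality with the bare integral is
  -- local at `x`.
  · filter_upwards [hpos] with ξ hξ
    unfold potential
    field_simp
  · ext v
    simp [gradConst]
    ring

end HeatDirichlet

end

/-! ### Polar coordinates, isometry invariance and rearrangement on the sphere -/

noncomputable section

section Polar

open MeasureTheory Filter

theorem lintegral_eq_lintegral_toSphere {E : Type*} [NormedAddCommGroup E] [NormedSpace ℝ E]
    [MeasurableSpace E] [BorelSpace E] [FiniteDimensional ℝ E] [Nontrivial E] (μ : Measure E)
    [μ.IsAddHaarMeasure] {Φ : E → ℝ≥0∞} (hΦ : Measurable Φ) :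
    ∫⁻ x, Φ x ∂μ = ∫⁻ σ, (∫⁻ r in Set.Ioi (0 : ℝ),
      ENNReal.ofReal (r ^ (Module.finrank ℝ E - 1)) * Φ (r • (σ : E))) ∂μ.toSphere := by
  have hm : Measurable fun p : Metric.sphere (0 : E) 1 × Set.Ioi (0 : ℝ) =>
      Φ ((p.2 : ℝ) • (p.1 : E)) := by fun_prop
  calc ∫⁻ x, Φ x ∂μ = ∫⁻ x in ({0}ᶜ : Set E), Φ x ∂μ := by rw [restrict_compl_singleton]
    _ = ∫⁻ x : ({0}ᶜ : Set E), Φ x ∂(μ.comap (↑)) :=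
      (lintegral_subtype_comap (measurableSet_singleton _).compl _).symm
    _ = ∫⁻ p, Φ ((p.2 : ℝ) • (p.1 : E))
          ∂μ.toSphere.prod (.volumeIoiPow (Module.finrank ℝ E - 1)) := by
      rw [← μ.measurePreserving_homeomorphUnitSphereProd.lintegral_comp hm]
      refine lintegral_congr fun x => ?_
      have := congrArg Subtype.val ((homeomorphUnitSphereProd E).symm_apply_apply x)
      rw [homeomorphUnitSphereProd_symm_apply_coe] at this
      rw [this]
    _ = _ := by
      rw [lintegral_prod _ hm.aemeasurable]
      refine lintegral_congr fun σ => ?_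
      rw [Measure.volumeIoiPow, lintegral_withDensity_eq_lintegral_mul _ (by fun_prop)
          (by fun_prop),
        ← lintegral_subtype_comap measurableSet_Ioi]
      rfl

theorem lintegral_Ioo_zero_pow {b : ℝ} (hb : 0 ≤ b) (k : ℕ) :
    ∫⁻ r in Set.Ioo (0 : ℝ) b, ENNReal.ofReal (r ^ k) =
      ENNReal.ofReal (b ^ (k + 1) / (k + 1)) := by
  rw [Measure.restrict_congr_set Ioo_ae_eq_Ioc, ← ofReal_integral_eq_lintegral_ofReal,
    ← intervalIntegral.integral_of_le hb]
  · simp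
  · exact (intervalIntegral.intervalIntegrable_pow _).1
  · filter_upwards [ae_restrict_mem measurableSet_Ioc] with y hy
    exact pow_nonneg hy.1.le _

variable {E : Type*} [NormedAddCommGroup E] [InnerProductSpace ℝ E]
    [MeasurableSpace E] [BorelSpace E] [FiniteDimensional ℝ E] [Nontrivial E]

/-- Extending `F` to be homogeneous of degree zero expresses a sphere integral through Lebesgue
measure on the ball, from which invariance under isometries is inherited. The factor is `∫₀¹ r^{d-1}
dr = 1/d`. -/
theorem lintegral_ball_normalize {F : E → ℝ≥0∞} (hF : Measurable F) :
    ∫⁻ x, (Metric.ball (0 : E) 1).indicator (fun x => F (‖x‖⁻¹ • x)) x =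
      (∫⁻ σ, F (σ : E) ∂(volume : Measure E).toSphere) *
        ENNReal.ofReal (1 / Module.finrank ℝ E) := by
  rw [lintegral_eq_lintegral_toSphere volume
    ((by fun_prop : Measurable fun x : E => F (‖x‖⁻¹ • x)).indicator measurableSet_ball),
    ← lintegral_mul_const _ (by fun_prop)]
  have hd : ((Module.finrank ℝ E - 1 : ℕ) : ℝ) + 1 = Module.finrank ℝ E := by
    exact_mod_cast Nat.sub_add_cancel (Module.finrank_pos (R := ℝ) (M := E))
  refine lintegral_congr fun σ => ?_
  have hσ : ‖(σ : E)‖ = 1 := by simp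
  have h1 : ∀ r ∈ Set.Ioi (0 : ℝ), ENNReal.ofReal (r ^ (Module.finrank ℝ E - 1)) *
      (Metric.ball (0 : E) 1).indicator (fun x => F (‖x‖⁻¹ • x)) (r • (σ : E)) =
      (Set.Iio (1 : ℝ)).indicator
        (fun r => ENNReal.ofReal (r ^ (Module.finrank ℝ E - 1)) * F σ) r := by
    intro r hr
    have hr0 : (0 : ℝ) < r := hr
    have hn : ‖r • (σ : E)‖ = r := by rw [norm_smul, hσ, mul_one, Real.norm_of_nonneg hr0.le]
    by_cases h : r < 1
    · rw [Set.indicator_of_mem (by simpa [hn] using h), Set.indicator_of_mem (by simpa using h),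
        hn, smul_smul, inv_mul_cancel₀ hr0.ne', one_smul]
    · rw [Set.indicator_of_notMem (by simpa [hn] using h),
        Set.indicator_of_notMem (by simpa using h), mul_zero]
  rw [setLIntegral_congr_fun measurableSet_Ioi h1, lintegral_indicator measurableSet_Iio,
    Measure.restrict_restrict measurableSet_Iio, Set.inter_comm, Set.Ioi_inter_Iio,
    lintegral_mul_const _ (by fun_prop), lintegral_Ioo_zero_pow zero_le_one, mul_comm, hd, one_pow]

theorem lintegral_toSphere_comp_linearIsometryEquiv (R : E ≃ₗᵢ[ℝ] E) {F : E → ℝ≥0∞}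
    (hF : Measurable F) :
    ∫⁻ σ, F (R (σ : E)) ∂(volume : Measure E).toSphere =
      ∫⁻ σ, F (σ : E) ∂(volume : Measure E).toSphere := by
  have hRm : Measurable R := R.continuous.measurable
  have h1 := lintegral_ball_normalize hF
  have h2 := lintegral_ball_normalize (hF.comp hRm)
  have h3 : ∫⁻ x, (Metric.ball (0 : E) 1).indicator (fun x => (F ∘ R) (‖x‖⁻¹ • x)) x =
      ∫⁻ x, (Metric.ball (0 : E) 1).indicator (fun x => F (‖x‖⁻¹ • x)) x := by
    rw [← R.measurePreserving.lintegral_comp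
      ((by fun_prop : Measurable fun x : E => F (‖x‖⁻¹ • x)).indicator measurableSet_ball)]
    refine lintegral_congr fun x => ?_
    by_cases h : ‖x‖ < 1
    · rw [Set.indicator_of_mem (by simpa using h), Set.indicator_of_mem (by simpa using h)]
      simp
    · rw [Set.indicator_of_notMem (by simpa using h), Set.indicator_of_notMem (by simpa using h)]
  rw [h1, h2] at h3
  have : 0 < Module.finrank ℝ E := Module.finrank_pos
  exact (ENNReal.mul_left_inj (by simpa using this.ne') ENNReal.ofReal_ne_top).1 h3

theorem ENNReal.mul_add_mul_le_of_le {a b c d : ℝ≥0∞} (hab : a ≤ b) (hcd : c ≤ d) :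
    a * d + b * c ≤ a * c + b * d := by
  obtain ⟨k, rfl⟩ := exists_add_of_le hab
  calc a * d + (a + k) * c = a * c + a * d + k * c := by ring
    _ ≤ a * c + a * d + k * d := by gcongr
    _ = _ := by ring

/-- A product of two increasing functions of `|(σ, e)|` and `|(σ, z)|` has the largest integral over
the sphere when the two directions agree. -/
theorem lintegral_toSphere_mul_le {F G : ℝ → ℝ≥0∞} (hF : MonotoneOn F (Set.Ici 0))
    (hG : MonotoneOn G (Set.Ici 0)) (hFm : Measurable F) (hGm : Measurable G) {e z : E}
    (he : ‖e‖ = ‖z‖) :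
    ∫⁻ σ, F |inner ℝ (σ : E) e| * G |inner ℝ (σ : E) z| ∂(volume : Measure E).toSphere ≤
      ∫⁻ σ, F |inner ℝ (σ : E) e| * G |inner ℝ (σ : E) e| ∂(volume : Measure E).toSphere := by
  -- As `‖e‖ = ‖z‖`, this reflection swaps `e` and `z`. Adding each integral to its reflected copy
  -- reduces the claim to a pointwise rearrangement inequality.
  set R := ((ℝ ∙ (e - z))ᗮ).reflection with hR
  have hRe : R e = z := Submodule.reflection_sub he
  have hRz : R z = e := by rw [← hRe, Submodule.reflection_reflection]
  have hin : ∀ x y : E, inner ℝ (R x) y = inner ℝ x (R y) := fun x y => by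
    rw [← R.inner_map_map x (R y), Submodule.reflection_reflection]
  have m1 : Measurable fun x : E => F |inner ℝ x e| * G |inner ℝ x e| := by fun_prop
  have m2 : Measurable fun x : E => F |inner ℝ x e| * G |inner ℝ x z| := by fun_prop
  have s1 := lintegral_toSphere_comp_linearIsometryEquiv R m1
  have s2 := lintegral_toSphere_comp_linearIsometryEquiv R m2
  simp only [hin, hRe, hRz] at s1 s2
  have key : ∫⁻ σ, (F |inner ℝ (σ : E) e| * G |inner ℝ (σ : E) z| +
        F |inner ℝ (σ : E) z| * G |inner ℝ (σ : E) e|) ∂(volume : Measure E).toSphere ≤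
      ∫⁻ σ, (F |inner ℝ (σ : E) e| * G |inner ℝ (σ : E) e| +
        F |inner ℝ (σ : E) z| * G |inner ℝ (σ : E) z|) ∂(volume : Measure E).toSphere := by
    have hn : ∀ c : ℝ, |c| ∈ Set.Ici (0 : ℝ) := abs_nonneg
    refine lintegral_mono fun σ => ?_
    rcases le_total |inner ℝ (σ : E) e| |inner ℝ (σ : E) z| with h | h
    · exact ENNReal.mul_add_mul_le_of_le (hF (hn _) (hn _) h) (hG (hn _) (hn _) h)
    · simpa only [add_comm] using
        ENNReal.mul_add_mul_le_of_le (hF (hn _) (hn _) h) (hG (hn _) (hn _) h)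
  rw [lintegral_add_left (by fun_prop), lintegral_add_left (by fun_prop), s1, s2, ← two_mul,
    ← two_mul] at key
  exact (ENNReal.mul_le_mul_iff_right two_ne_zero ENNReal.ofNat_ne_top).1 key

end Polar

/-! ### Central projection between the sphere and a hyperplane -/

namespace HeatDirichlet

open MeasureTheory Filter

variable {m : ℕ}

@[fun_prop]
theorem measurable_tangential : Measurable (tangential : Space m → Bdry m) := by
  unfold tangential
  fun_prop

theorem tangential_smul (c : ℝ) (x : Space m) : tangential (c • x) = c • tangential x := by
  ext i
  simp [tangential]

theorem measurePreserving_last_tangential :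
    MeasurePreserving (fun x : Space m => (x (Fin.last m), tangential x)) volume
      (volume.prod volume) := by
  have h1 := EuclideanSpace.volume_preserving_symm_measurableEquiv_toLp (Fin (m + 1))
  have h2 := volume_preserving_piFinSuccAbove (fun _ : Fin (m + 1) => ℝ) (Fin.last m)
  have h3 := (MeasurePreserving.id (volume : Measure ℝ)).prod
    (EuclideanSpace.volume_preserving_symm_measurableEquiv_toLp (Fin m)).symm
  have h := h3.comp (h2.comp h1)
  have hf : Prod.map id (MeasurableEquiv.toLp 2 (Fin m → ℝ)).symm.symm ∘
      MeasurableEquiv.piFinSuccAbove (fun _ => ℝ) (Fin.last m) ∘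
        (MeasurableEquiv.toLp 2 (Fin (m + 1) → ℝ)).symm =
      fun x : Space m => (x (Fin.last m), tangential x) := by
    funext x
    refine Prod.ext rfl ?_
    ext i
    simp [tangential, MeasurableEquiv.piFinSuccAbove, Fin.init]
  rw [hf] at h
  exact h

theorem lintegral_comp_inv_smul {H : Bdry m → ℝ≥0∞} (hH : Measurable H) {s : ℝ} (hs : s ≠ 0) :
    ∫⁻ y, H (s⁻¹ • y) = ENNReal.ofReal (|s| ^ m) * ∫⁻ y, H y := by
  have h := Measure.map_addHaar_smul (volume : Measure (Bdry m)) (inv_ne_zero hs)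
  rw [← lintegral_map hH (by fun_prop), h, lintegral_smul_measure]
  simp [abs_pow]

/-- Central projection of the sphere from the origin to the hyperplane `x_n = 1`. -/
theorem two_mul_lintegral_eq_lintegral_toSphere {H : Bdry m → ℝ≥0∞} (hH : Measurable H) :
    2 * ∫⁻ y, H y = ∫⁻ σ : Metric.sphere (0 : Space m) 1,
      ENNReal.ofReal ((|(σ : Space m) (Fin.last m)|⁻¹) ^ (m + 1)) *
        H (((σ : Space m) (Fin.last m))⁻¹ • tangential (σ : Space m))
      ∂(volume : Measure (Space m)).toSphere := by
  set S : Set ℝ := {s | 0 < |s| ∧ |s| < 1} with hS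
  have hSm : MeasurableSet S := by measurability
  -- The cone-wise extension of `H`, cut to the slab `0 < |x_n| < 1`, is integrated twice. Slicing
  -- by `x_n` gives `2/(m+1) ∫ H`, one half from each sign of `x_n`; in polar coordinates a ray in
  -- direction `σ` stays in the slab for `r < 1/|σ_n|`, which produces the Jacobian
  -- `|σ_n|^{-(m+1)}/(m+1)`.
  set G : ℝ × Bdry m → ℝ≥0∞ := fun v => S.indicator (fun _ => 1) v.1 * H (v.1⁻¹ • v.2) with hG
  have hGm : Measurable G := by
    have : Measurable (S.indicator fun _ : ℝ => (1 : ℝ≥0∞)) := measurable_const.indicator hSm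
    fun_prop
  have hΦm : Measurable fun x : Space m => G (x (Fin.last m), tangential x) := by fun_prop
  have hA := measurePreserving_last_tangential.lintegral_comp hGm
  rw [lintegral_prod _ hGm.aemeasurable] at hA
  have hS2 : ∫⁻ s in S, ENNReal.ofReal (|s| ^ m) = 2 * ENNReal.ofReal (1 / (m + 1)) := by
    have hSu : S = Set.Ioo 0 1 ∪ Neg.neg ⁻¹' (Set.Ioo 0 1) := by
      ext s
      simp only [hS, Set.mem_ofPred_eq, Set.mem_union, Set.mem_preimage, Set.mem_Ioo, abs_lt,
        abs_pos]
      constructor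
      · rintro ⟨h0, h1, h2⟩
        rcases lt_or_gt_of_ne h0 with h | h
        · right; constructor <;> linarith
        · left; constructor <;> linarith
      · rintro (⟨h1, h2⟩ | ⟨h1, h2⟩)
        · exact ⟨h1.ne', by linarith, by linarith⟩
        · exact ⟨(neg_pos.1 h1).ne, by linarith, by linarith⟩
    have h1 : ∫⁻ s in Set.Ioo (0 : ℝ) 1, ENNReal.ofReal (|s| ^ m) =
        ENNReal.ofReal (1 / (m + 1)) := by
      rw [show (1 : ℝ) / (m + 1) = 1 ^ (m + 1) / (m + 1) by rw [one_pow],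
        ← lintegral_Ioo_zero_pow zero_le_one]
      refine setLIntegral_congr_fun measurableSet_Ioo fun s hs => ?_
      simp only [abs_of_pos hs.1]
    rw [hSu, lintegral_union (measurable_neg measurableSet_Ioo)]
    · have h2 := (Measure.measurePreserving_neg (volume : Measure ℝ)).setLIntegral_comp_preimage
        (measurableSet_Ioo (a := (0 : ℝ)) (b := 1))
        (f := fun s => ENNReal.ofReal (|s| ^ m)) (by fun_prop)
      simp only [abs_neg] at h2
      rw [h2, h1, two_mul]
    · rw [Set.disjoint_left]
      rintro s ⟨h1, _⟩ ⟨h2, _⟩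
      linarith
  have hL : ∫⁻ s, ∫⁻ y, G (s, y) = 2 * ENNReal.ofReal (1 / (m + 1)) * ∫⁻ y, H y := by
    rw [← hS2, ← lintegral_mul_const _ (by fun_prop), ← lintegral_indicator hSm]
    refine lintegral_congr fun s => ?_
    by_cases hs : s ∈ S
    · simp only [hG, Set.indicator_of_mem hs, one_mul]
      exact lintegral_comp_inv_smul hH (abs_pos.1 hs.1)
    · simp [hG, Set.indicator_of_notMem hs]
  rw [hL, lintegral_eq_lintegral_toSphere volume hΦm] at hA
  have hR : ∀ σ : Metric.sphere (0 : Space m) 1, ∫⁻ r in Set.Ioi (0 : ℝ),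
      ENNReal.ofReal (r ^ (Module.finrank ℝ (Space m) - 1)) *
        G ((r • (σ : Space m)) (Fin.last m), tangential (r • (σ : Space m))) =
      ENNReal.ofReal ((|(σ : Space m) (Fin.last m)|⁻¹) ^ (m + 1)) *
        H (((σ : Space m) (Fin.last m))⁻¹ • tangential (σ : Space m)) *
        ENNReal.ofReal (1 / (m + 1)) := by
    intro σ
    set c := (σ : Space m) (Fin.last m) with hc
    have h1 : ∀ r ∈ Set.Ioi (0 : ℝ), ENNReal.ofReal (r ^ (Module.finrank ℝ (Space m) - 1)) *
        G ((r • (σ : Space m)) (Fin.last m), tangential (r • (σ : Space m))) =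
        (Set.Iio |c|⁻¹).indicator
          (fun r => ENNReal.ofReal (r ^ m) * H (c⁻¹ • tangential (σ : Space m))) r := by
      intro r hr
      have hr0 : (0 : ℝ) < r := hr
      have hd : Module.finrank ℝ (Space m) - 1 = m := by simp
      have hcr : (r • (σ : Space m)) (Fin.last m) = r * c := by simp [hc]
      rw [hd, hcr, tangential_smul]
      by_cases hc0 : c = 0
      -- On the equator both sides vanish, because `|0|⁻¹ = 0`.
      · have : r * c ∉ S := by simp [hS, hc0]
        rw [Set.indicator_of_notMem (by simpa [hc0] using hr0.le)]
        simp [hG, Set.indicator_of_notMem this]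
      · have hc1 : 0 < |c| := abs_pos.2 hc0
        have hmem : r * c ∈ S ↔ r ∈ Set.Iio |c|⁻¹ := by
          simp only [hS, Set.mem_ofPred_eq, abs_mul, abs_of_pos hr0, Set.mem_Iio]
          rw [lt_inv_comm₀ hr0 hc1, ← one_div, lt_div_iff₀ hr0, mul_comm]
          exact ⟨fun h => h.2, fun h => ⟨by positivity, h⟩⟩
        by_cases h : r * c ∈ S
        · rw [Set.indicator_of_mem (hmem.1 h)]
          simp only [hG, Set.indicator_of_mem h, one_mul, smul_smul]
          congr 3
          field_simp
        · rw [Set.indicator_of_notMem (fun h' => h (hmem.2 h'))]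
          simp [hG, Set.indicator_of_notMem h]
    rw [setLIntegral_congr_fun measurableSet_Ioi h1, lintegral_indicator measurableSet_Iio,
      Measure.restrict_restrict measurableSet_Iio, Set.inter_comm, Set.Ioi_inter_Iio,
      lintegral_mul_const _ (by fun_prop), lintegral_Ioo_zero_pow (by positivity),
      div_eq_mul_one_div, ENNReal.ofReal_mul (by positivity)]
    ring
  simp only [hR] at hA
  rw [lintegral_mul_const _ (by fun_prop), mul_right_comm] at hA
  exact ((ENNReal.mul_left_inj (by simpa using (by positivity : (0 : ℝ) < m + 1))
    ENNReal.ofReal_ne_top).1 hA).symm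

/-! ### The incomplete Gamma weight and the `L^Q` norm of the kernel -/

theorem integrableOn_rpow_mul_exp_neg {l : ℝ} (hl : -1 < l) {c : ℝ} (hc : 0 ≤ c) :
    IntegrableOn (fun ξ : ℝ => ξ ^ l * Real.exp (-ξ)) (Set.Ioi c) := by
  have h := Real.GammaIntegral_convergent (s := l + 1) (by linarith)
  simp only [add_sub_cancel_right, mul_comm (Real.exp _)] at h
  exact h.mono_set (Set.Ioi_subset_Ioi hc)

theorem rpow_mul_exp_neg_nonneg {l c : ℝ} (hc : 0 ≤ c) :
    ∀ ξ ∈ Set.Ioi c, 0 ≤ ξ ^ l * Real.exp (-ξ) := fun ξ hξ => by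
  have : (0 : ℝ) ≤ ξ := hc.trans (le_of_lt hξ)
  positivity

theorem omega_nonneg {κ l : ℝ} (hκ : 0 ≤ κ) (u : ℝ) : 0 ≤ omega κ l u := by
  unfold omega
  split_ifs
  · rfl
  · exact setIntegral_nonneg measurableSet_Ioi (rpow_mul_exp_neg_nonneg (by positivity))

theorem omega_abs (κ l u : ℝ) : omega κ l |u| = omega κ l u := by
  unfold omega
  simp [sq_abs]

theorem ofReal_omega {κ l : ℝ} (hκ : 0 ≤ κ) (hl : -1 < l) {u : ℝ} (hu : u ≠ 0) :
    ENNReal.ofReal (omega κ l u) =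
      ∫⁻ ξ in Set.Ioi (κ / u ^ 2), ENNReal.ofReal (ξ ^ l * Real.exp (-ξ)) := by
  have hc : 0 ≤ κ / u ^ 2 := by positivity
  rw [omega, if_neg hu, ofReal_integral_eq_lintegral_ofReal (integrableOn_rpow_mul_exp_neg hl hc)]
  filter_upwards [ae_restrict_mem measurableSet_Ioi] with ξ hξ
  exact rpow_mul_exp_neg_nonneg hc ξ hξ

/-- The lower limit `κ/u²` decreases in `u`. This monotonicity is what decides the extremal problem.
-/
theorem omega_le_omega {κ l : ℝ} (hκ : 0 ≤ κ) (hl : -1 < l) {u v : ℝ} (hu : 0 ≤ u) (huv : u ≤ v) :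
    omega κ l u ≤ omega κ l v := by
  rcases hu.eq_or_lt with rfl | hu0
  · rw [omega, if_pos rfl]
    exact omega_nonneg hκ v
  · have hv0 : 0 < v := hu0.trans_le huv
    have hc : 0 ≤ κ / v ^ 2 := by positivity
    rw [omega, if_neg hu0.ne', omega, if_neg hv0.ne']
    refine setIntegral_mono_set (integrableOn_rpow_mul_exp_neg hl hc) ?_ ?_
    · filter_upwards [ae_restrict_mem measurableSet_Ioi] with ξ hξ
      exact rpow_mul_exp_neg_nonneg hc ξ hξ
    · refine LE.le.eventuallyLE (Set.Ioi_subset_Ioi ?_)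
      gcongr

/-- The weight `ω_{κ,l}(u) u^α`, extended by zero to negative `u`. -/
def weight (κ l α u : ℝ) : ℝ := omega κ l (max u 0) * (max u 0) ^ α

theorem weight_nonneg {κ : ℝ} (hκ : 0 ≤ κ) (l α u : ℝ) : 0 ≤ weight κ l α u :=
  mul_nonneg (omega_nonneg hκ _) (Real.rpow_nonneg (le_max_right _ _) _)

theorem weight_abs (κ l α u : ℝ) : weight κ l α |u| = omega κ l u * |u| ^ α := by
  rw [weight, max_eq_left (abs_nonneg u), omega_abs]

theorem weight_monotone {κ l α : ℝ} (hκ : 0 ≤ κ) (hl : -1 < l) (hα : 0 ≤ α) :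
    Monotone (weight κ l α) := fun u v huv => by
  have h : max u 0 ≤ max v 0 := max_le_max huv le_rfl
  refine mul_le_mul (omega_le_omega hκ hl (le_max_right _ _) h)
    (Real.rpow_le_rpow (le_max_right _ _) h hα) (Real.rpow_nonneg (le_max_right _ _) _)
    (omega_nonneg hκ _)

/-- Substitute `ξ = β/(t-τ)`: the Jacobian `β/(t-τ)²` takes up two of the `l + 2` powers, whence the
`-2` in `λ`. -/
theorem lintegral_time {β t l : ℝ} (hβ : 0 < β) (ht : 0 < t) :
    ∫⁻ τ in Set.Ioo (0 : ℝ) t,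
        ENNReal.ofReal (Real.exp (-(β / (t - τ))) * (t - τ) ^ (-(l + 2))) =
      ENNReal.ofReal (β ^ (-(l + 1))) *
        ∫⁻ ξ in Set.Ioi (β / t), ENNReal.ofReal (ξ ^ l * Real.exp (-ξ)) := by
  have himg : (fun τ => β / (t - τ)) '' Set.Ioo 0 t = Set.Ioi (β / t) := by
    ext ξ
    simp only [Set.mem_image, Set.mem_Ioo, Set.mem_Ioi]
    constructor
    · rintro ⟨τ, ⟨h0, h1⟩, rfl⟩
      have : 0 < t - τ := sub_pos.2 h1
      gcongr
      linarith
    · intro h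
      have hξ : 0 < ξ := lt_trans (by positivity) h
      refine ⟨t - β / ξ, ⟨?_, ?_⟩, ?_⟩
      · rw [div_lt_iff₀ ht] at h
        rw [sub_pos, div_lt_iff₀ hξ]
        linarith
      · have : 0 < β / ξ := by positivity
        linarith
      · rw [sub_sub_cancel, div_div_cancel₀ hβ.ne']
  have hder : ∀ τ ∈ Set.Ioo 0 t, HasDerivWithinAt (fun τ => β / (t - τ)) (β / (t - τ) ^ 2)
      (Set.Ioo 0 t) τ := fun τ hτ => by
    have hs : t - τ ≠ 0 := (sub_pos.2 hτ.2).ne'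
    have h := ((hasDerivAt_const τ β).div ((hasDerivAt_id τ).const_sub t) hs)
    refine (h.congr_deriv ?_).hasDerivWithinAt
    simp
  have hinj : Set.InjOn (fun τ => β / (t - τ)) (Set.Ioo 0 t) := fun u hu v hv huv => by
    have h1 : t - u ≠ 0 := (sub_pos.2 hu.2).ne'
    have h2 : t - v ≠ 0 := (sub_pos.2 hv.2).ne'
    simp only [div_eq_div_iff h1 h2] at huv
    have := mul_left_cancel₀ hβ.ne' huv
    linarith
  rw [← himg, lintegral_image_eq_lintegral_abs_deriv_mul measurableSet_Ioo hder hinj,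
    ← lintegral_const_mul _ (by fun_prop)]
  refine setLIntegral_congr_fun measurableSet_Ioo fun τ hτ => ?_
  have hs : 0 < t - τ := sub_pos.2 hτ.2
  rw [← ENNReal.ofReal_mul (by positivity), ← ENNReal.ofReal_mul (by positivity),
    abs_of_pos (by positivity), Real.div_rpow hβ.le hs.le, neg_add, Real.rpow_add hs,
    Real.rpow_neg hs.le, neg_add, Real.rpow_add hβ, Real.rpow_neg hβ.le, Real.rpow_neg_one,
    Real.rpow_neg hs.le, Real.rpow_two]
  congr 1
  field_simp

/-- The line through `x` in direction `σ` meets the boundary here, so distances and inner products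
in the kernel become functions of `σ`. -/
theorem sub_bdryPoint_central (x : Space m) {σ : Space m} (hσ : σ (Fin.last m) ≠ 0) :
    x - bdryPoint (tangential x - x (Fin.last m) • ((σ (Fin.last m))⁻¹ • tangential σ)) =
      (x (Fin.last m) / σ (Fin.last m)) • σ := by
  ext i
  refine Fin.lastCases ?_ (fun j => ?_) i
  · simp [bdryPoint_last, hσ]
  · simp [bdryPoint_castSucc, tangential]
    ring

theorem lintegral_affine {H : Bdry m → ℝ≥0∞} (hH : Measurable H) (v : Bdry m) {h : ℝ}
    (hh : 0 < h) : ∫⁻ y, H y = ENNReal.ofReal (h ^ m) * ∫⁻ w, H (v - h • w) := by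
  have h1 := lintegral_comp_inv_smul (H := fun w => H (v - h • w)) (by fun_prop) hh.ne'
  simp only [smul_smul, mul_inv_cancel₀ hh.ne', one_smul, abs_of_pos hh] at h1
  rw [← h1, lintegral_sub_left_eq_self]

/-- The constant relating the `L^Q` norm of the kernel to an integral over the sphere. -/
def kernelConst (m : ℕ) (a h Q : ℝ) : ℝ :=
  (1 / 2) * ((Q / (4 * a ^ 2)) ^ (-((((m + 1 : ℕ) : ℝ) + 4) * Q / 2 - 2 + 1)) *
    h ^ ((m : ℝ) + Q - 2 * ((((m + 1 : ℕ) : ℝ) + 4) * Q / 2 - 2 + 1)))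

/-- After time is integrated out, the integrand is `|(x-y,z)|^Q` times a function `J` of `|x-y| =
h/|σ_n|`. The exponent of `|σ_n|` collects `-n` from the projection, `-Q` from the inner product and
`2(l+1)` from `J`. -/
theorem lintegral_gradKernel_rpow {a t Q : ℝ} (ha : a ≠ 0) (ht : 0 < t) (hQ : 1 ≤ Q)
    {x : Space m} (hx : 0 < x (Fin.last m)) (z : Space m) :
    ∫⁻ w in layer m t, ENNReal.ofReal (|inner ℝ (gradKernel a t x w) z| ^ Q) =
      ENNReal.ofReal (kernelConst m a (x (Fin.last m)) Q) *
        ∫⁻ σ : Metric.sphere (0 : Space m) 1,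
          ENNReal.ofReal (weight (Q * x (Fin.last m) ^ 2 / (4 * a ^ 2 * t))
            ((((m + 1 : ℕ) : ℝ) + 4) * Q / 2 - 2)
            (Q * (((m + 1 : ℕ) : ℝ) + 3) - (((m + 1 : ℕ) : ℝ) + 2))
            |inner ℝ (σ : Space m) (eLast m)|) *
          ENNReal.ofReal (|inner ℝ (σ : Space m) z| ^ Q)
          ∂(volume : Measure (Space m)).toSphere := by
  set h := x (Fin.last m) with hh
  set n : ℝ := ((m + 1 : ℕ) : ℝ) with hn
  set l : ℝ := (n + 4) * Q / 2 - 2 with hl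
  set κ : ℝ := Q * h ^ 2 / (4 * a ^ 2 * t) with hκ
  have hn2 : (1 : ℝ) ≤ n := by rw [hn]; push_cast; linarith [(Nat.cast_nonneg m : (0 : ℝ) ≤ m)]
  have hl1 : -1 < l := by rw [hl]; nlinarith
  have hQ0 : 0 < Q := by linarith
  set J : ℝ → ℝ≥0∞ := fun R => ENNReal.ofReal ((Q * R ^ 2 / (4 * a ^ 2)) ^ (-(l + 1))) *
    ∫⁻ ξ in Set.Ioi (Q * R ^ 2 / (4 * a ^ 2) / t), ENNReal.ofReal (ξ ^ l * Real.exp (-ξ)) with hJ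
  set H : Bdry m → ℝ≥0∞ := fun y => ∫⁻ τ in Set.Ioo (0 : ℝ) t,
    ENNReal.ofReal (|inner ℝ (gradKernel a t x (y, τ)) z| ^ Q) with hH
  have hmeas : Measurable fun w : Bdry m × ℝ =>
      ENNReal.ofReal (|inner ℝ (gradKernel a t x w) z| ^ Q) := by fun_prop
  have hHm : Measurable H := hmeas.lintegral_prod_right'
  have hHJ : ∀ y, H y = ENNReal.ofReal (|inner ℝ (x - bdryPoint y) z| ^ Q) *
      J ‖x - bdryPoint y‖ := by
    intro y
    have hR : 0 < ‖x - bdryPoint y‖ := hx.trans_le (last_le_norm_sub_bdryPoint x y)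
    simp only [hJ]
    rw [← lintegral_time (by positivity) ht, ← lintegral_const_mul _ (by fun_prop)]
    refine setLIntegral_congr_fun measurableSet_Ioo fun τ hτ => ?_
    have hs : 0 < t - τ := sub_pos.2 hτ.2
    simp only [gradKernel]
    rw [real_inner_smul_left, abs_mul, abs_of_nonneg (by positivity),
      ← ENNReal.ofReal_mul (by positivity), mul_comm,
      Real.mul_rpow (abs_nonneg _) (by positivity), Real.div_rpow (by positivity) (by positivity),
      ← Real.exp_mul, ← Real.rpow_mul hs.le, Real.rpow_neg hs.le, div_eq_mul_inv]
    have e1 : (n + 4) / 2 * Q = l + 2 := by rw [hl]; ring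
    have e2 : -(‖x - bdryPoint y‖ ^ 2 / (4 * a ^ 2 * (t - τ))) * Q =
        -(Q * ‖x - bdryPoint y‖ ^ 2 / (4 * a ^ 2) / (t - τ)) := by
      field_simp
    rw [e1, e2]
  rw [volume_restrict_layer, lintegral_prod _ hmeas.aemeasurable]
  change ∫⁻ y, H y = _
  rw [lintegral_affine hHm (tangential x) hx]
  have hsph := two_mul_lintegral_eq_lintegral_toSphere
    (H := fun w => H (tangential x - h • w)) (by fun_prop)
  have hhalf : ∀ X : ℝ≥0∞, ENNReal.ofReal (1 / 2) * (2 * X) = X := fun X => by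
    rw [← mul_assoc, show (2 : ℝ≥0∞) = ENNReal.ofReal 2 by simp,
      ← ENNReal.ofReal_mul (by norm_num)]
    norm_num
  have hB : 0 < (Q / (4 * a ^ 2)) ^ (-(l + 1)) * h ^ ((m : ℝ) + Q - 2 * (l + 1)) := by positivity
  have hK : ENNReal.ofReal (kernelConst m a h Q) = ENNReal.ofReal (1 / 2) *
      ENNReal.ofReal ((Q / (4 * a ^ 2)) ^ (-(l + 1)) * h ^ ((m : ℝ) + Q - 2 * (l + 1))) := by
    rw [← ENNReal.ofReal_mul (by norm_num)]
    rfl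
  rw [← hhalf (∫⁻ w, H (tangential x - h • w)), hsph, hK, mul_left_comm, mul_assoc]
  congr 1
  rw [← lintegral_const_mul' _ _ ENNReal.ofReal_ne_top,
    ← lintegral_const_mul' _ _ ENNReal.ofReal_ne_top]
  refine lintegral_congr fun σ => ?_
  rw [weight_abs, inner_eLast]
  set c := (σ : Space m) (Fin.last m) with hc
  by_cases hc0 : c = 0
  · simp [hc0, omega]
  have hc1 : 0 < |c| := abs_pos.2 hc0
  have hσ : ‖(σ : Space m)‖ = 1 := by simp
  have hβ : Q * (h / |c|) ^ 2 / (4 * a ^ 2) / t = κ / c ^ 2 := by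
    rw [hκ, div_pow, sq_abs]
    field_simp
  rw [hHJ, sub_bdryPoint_central x hc0, norm_smul, hσ, mul_one, real_inner_smul_left, abs_mul,
    Real.norm_eq_abs, abs_div, abs_of_pos hx]
  simp only [hJ, ← hc]
  rw [hβ, ← ofReal_omega (by positivity) hl1 hc0]
  have hω : 0 ≤ omega κ l c := omega_nonneg (by positivity) c
  have hd : 0 < h / |c| := by positivity
  rw [← ENNReal.ofReal_mul (by positivity), ← ENNReal.ofReal_mul (by positivity),
    ← ENNReal.ofReal_mul (by positivity), ← ENNReal.ofReal_mul (by positivity),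
    ← ENNReal.ofReal_mul (by positivity), ← ENNReal.ofReal_mul (by positivity)]
  congr 1
  have e1 : Q * (h / |c|) ^ 2 / (4 * a ^ 2) = Q / (4 * a ^ 2) * (h / |c|) ^ (2 : ℝ) := by
    rw [Real.rpow_two]; ring
  have e2 : (|c|⁻¹) ^ (m + 1) = |c| ^ (-n) := by
    rw [Real.rpow_neg hc1.le, hn, Real.rpow_natCast, inv_pow]
  have e3 : h ^ m = h ^ (m : ℝ) := (Real.rpow_natCast _ _).symm
  have e4 : Q * (n + 3) - (n + 2) = -n + (-Q + 2 * (l + 1)) := by rw [hl]; ring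
  have e5 : (m : ℝ) + Q - 2 * (l + 1) = m + (Q + 2 * -(l + 1)) := by ring
  rw [e1, e2, e3, e4, e5, Real.mul_rpow hd.le (abs_nonneg _),
    Real.mul_rpow (by positivity) (by positivity), ← Real.rpow_mul hd.le,
    Real.rpow_add hx, Real.rpow_add hx, Real.rpow_add hc1,
    Real.rpow_add hc1, Real.div_rpow hx.le hc1.le, Real.div_rpow hx.le hc1.le,
    Real.rpow_neg hc1.le Q, show (2 : ℝ) * -(l + 1) = -(2 * (l + 1)) by ring,
    Real.rpow_neg hc1.le (2 * (l + 1))]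
  field_simp

/-! ### Exponents and constants, uniformly for `1 < p ≤ ∞` -/

section Exponents

variable {p : ℝ≥0∞}

theorem one_lt_toReal (hp : 1 < p) (ht : p ≠ ∞) : 1 < p.toReal := by
  rw [← ENNReal.toReal_one]
  exact (ENNReal.toReal_lt_toReal ENNReal.one_ne_top ht).2 hp

theorem one_le_conj (hp : 1 < p) : 1 ≤ conj p := by
  unfold conj
  split_ifs with h
  · rfl
  · have := one_lt_toReal hp h
    rw [le_div_iff₀ (by linarith)]
    linarith

theorem one_sub_recip (hp : 1 < p) : 1 - recip p = 1 / conj p := by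
  unfold conj recip
  split_ifs with h
  · simp [h]
  · have := one_lt_toReal hp h
    have h1 : p.toReal - 1 ≠ 0 := by linarith
    rw [ENNReal.toReal_inv]
    field_simp

theorem ofReal_conj (hp : 1 < p) : ENNReal.ofReal (conj p) = p.conjExponent := by
  have h1 := ENNReal.HolderConjugate.conjExponent hp.le
  have h2 : p.HolderConjugate (ENNReal.ofReal (conj p)) := by
    unfold conj
    split_ifs with h
    · rw [h, ENNReal.ofReal_one]
      infer_instance
    · have := (Real.HolderConjugate.conjExponent (one_lt_toReal hp h)).ennrealOfReal
      rwa [ENNReal.ofReal_toReal h] at this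
  exact ENNReal.HolderConjugate.unique p _ _

/-- An affine expression in the conjugate exponent, so `p = ∞` needs no separate treatment later. -/
theorem weightExp_eq (n : ℕ) (hp : 1 < p) :
    weightExp n p = conj p * ((n : ℝ) + 3) - ((n : ℝ) + 2) := by
  unfold weightExp conj
  split_ifs with h
  · ring
  · have := one_lt_toReal hp h
    have h1 : p.toReal - 1 ≠ 0 := by linarith
    field_simp
    ring

theorem cosExp_eq (n : ℕ) (p : ℝ≥0∞) : cosExp n p = weightExp n p + conj p := by
  unfold cosExp weightExp conj
  split_ifs with h
  · norm_num
  · rw [← add_div]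
    ring

theorem gradConst_pos (n : ℕ) {a : ℝ} (ha : a ≠ 0) : 0 < gradConst n a := by
  have := Real.pi_pos
  unfold gradConst
  positivity

theorem kernelConst_pos (m : ℕ) {a h Q : ℝ} (ha : a ≠ 0) (hh : 0 < h) (hQ : 0 < Q) :
    0 < kernelConst m a h Q := by
  unfold kernelConst
  positivity

theorem gradConst_mul_kernelConst {a h : ℝ} (ha : a ≠ 0) (hh : 0 < h) (hp : 1 < p) :
    gradConst (m + 1) a * kernelConst m a h (conj p) ^ (1 / conj p) =
      prefactor (m + 1) a p h := by
  have hQ : 0 < conj p := zero_lt_one.trans_le (one_le_conj hp)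
  have hρ : recip p = 1 - 1 / conj p := by rw [← one_sub_recip hp]; ring
  have hpi := Real.pi_pos
  have hK := kernelConst_pos m ha hh hQ
  unfold prefactor cConst
  rw [hρ]
  -- Both sides are positive products of real powers; logarithms turn the claim into an identity
  -- linear in the logarithms of the bases.
  refine Real.log_injOn_pos (Set.mem_Ioi.2 (mul_pos (gradConst_pos _ ha) (by positivity)))
    (Set.mem_Ioi.2 (by positivity)) ?_
  have hb : (0 : ℝ) < 4 * a ^ 2 := by positivity
  have h2a : 2 * a ^ 2 = 4 * a ^ 2 / 2 := by ring
  unfold gradConst kernelConst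
  rw [h2a]
  generalize 4 * a ^ 2 = b at hb
  generalize conj p = Q at hQ
  rw [Real.log_mul (by positivity) (by positivity), Real.log_rpow (by positivity),
    Real.log_mul (by positivity) (by positivity), Real.log_mul (by positivity) (by positivity),
    Real.log_rpow (by positivity), Real.log_rpow (by positivity),
    Real.log_div (by positivity) (by positivity), Real.log_div (by positivity) (by positivity),
    Real.log_mul (by positivity) (by positivity), Real.log_rpow (by positivity),
    Real.log_mul (by positivity) (by positivity), Real.log_div (by positivity) (by positivity),
    Real.log_div (by positivity) (by positivity), Real.log_div (by positivity) (by positivity),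
    Real.log_div (by positivity) (by positivity),
    Real.log_mul (by positivity) (by positivity), Real.log_mul (by positivity) (by positivity),
    Real.log_rpow (by positivity), Real.log_rpow (by positivity), Real.log_rpow (by positivity),
    Real.log_rpow (by positivity), Real.log_rpow (by positivity), Real.log_one]
  push_cast
  field_simp
  ring

end Exponents

/-! ### Directional norms of the kernel and the extremal direction -/

/-- The lower integral over the sphere that determines the `L^Q` norm of the kernel. -/
def sphereLIntegral (m : ℕ) (a t Q h : ℝ) (z : Space m) : ℝ≥0∞ :=
  ∫⁻ σ : Metric.sphere (0 : Space m) 1,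
    ENNReal.ofReal (weight (Q * h ^ 2 / (4 * a ^ 2 * t))
      ((((m + 1 : ℕ) : ℝ) + 4) * Q / 2 - 2)
      (Q * (((m + 1 : ℕ) : ℝ) + 3) - (((m + 1 : ℕ) : ℝ) + 2))
      |inner ℝ (σ : Space m) (eLast m)|) *
    ENNReal.ofReal (|inner ℝ (σ : Space m) z| ^ Q)
    ∂(volume : Measure (Space m)).toSphere

theorem weight_monotone_of_one_le {a t Q h : ℝ} (ht : 0 < t) (hQ : 1 ≤ Q) :
    Monotone (weight (Q * h ^ 2 / (4 * a ^ 2 * t))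
      ((((m + 1 : ℕ) : ℝ) + 4) * Q / 2 - 2)
      (Q * (((m + 1 : ℕ) : ℝ) + 3) - (((m + 1 : ℕ) : ℝ) + 2))) := by
  have hm : (0 : ℝ) ≤ m := Nat.cast_nonneg m
  refine weight_monotone (by positivity) ?_ ?_
  · push_cast
    nlinarith
  · push_cast
    nlinarith

theorem sphereLIntegral_le {a t Q h : ℝ} (ht : 0 < t) (hQ : 1 ≤ Q)
    {z : Space m} (hz : ‖z‖ = 1) :
    sphereLIntegral m a t Q h z ≤ sphereLIntegral m a t Q h (eLast m) := by
  have hmono := weight_monotone_of_one_le (m := m) (a := a) (h := h) ht hQ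
  refine lintegral_toSphere_mul_le
    (F := fun u => ENNReal.ofReal (weight _ _ _ u)) (G := fun u => ENNReal.ofReal (u ^ Q))
    ((ENNReal.ofReal_mono.comp hmono).monotoneOn _) (fun u hu v _ huv => ?_)
    (ENNReal.measurable_ofReal.comp hmono.measurable) (by fun_prop) (by rw [norm_eLast, hz])
  exact ENNReal.ofReal_le_ofReal (Real.rpow_le_rpow hu huv (by linarith))

theorem eLpNorm_inner_gradKernel {a t Q : ℝ} (ha : a ≠ 0) (ht : 0 < t) (hQ : 1 ≤ Q)
    {x : Space m} (hx : 0 < x (Fin.last m)) (z : Space m) :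
    eLpNorm (fun w => inner ℝ (gradKernel a t x w) z) (ENNReal.ofReal Q)
        (volume.restrict (layer m t)) =
      (ENNReal.ofReal (kernelConst m a (x (Fin.last m)) Q) *
        sphereLIntegral m a t Q (x (Fin.last m)) z) ^ (1 / Q) := by
  have hQ0 : 0 < Q := by linarith
  rw [eLpNorm_eq_lintegral_rpow_enorm_toReal (by simpa using hQ0) ENNReal.ofReal_ne_top,
    ENNReal.toReal_ofReal hQ0.le, sphereLIntegral, ← lintegral_gradKernel_rpow ha ht hQ hx z]
  congr 1
  refine lintegral_congr fun w => ?_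
  rw [← ofReal_norm, ENNReal.ofReal_rpow_of_nonneg (norm_nonneg _) hQ0.le,
    Real.norm_eq_abs]

theorem memLp_inner_gradKernel {a t : ℝ} (ha : a ≠ 0) {x : Space m} (hx : 0 < x (Fin.last m))
    {q : ℝ≥0∞} (hq : 1 ≤ q) (z : Space m) :
    MemLp (fun w => inner ℝ (gradKernel a t x w) z) q (volume.restrict (layer m t)) := by
  refine (memLp_gradKernel (t := t) ha hx hq).of_le_mul (c := ‖z‖)
    (by fun_prop : Measurable fun w => inner ℝ (gradKernel a t x w) z).aestronglyMeasurable
    (Eventually.of_forall fun w => ?_)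
  rw [mul_comm]
  exact norm_inner_le_norm _ _

theorem eLpNorm_inner_gradKernel_le {a t : ℝ} (ha : a ≠ 0) (ht : 0 < t) {x : Space m}
    (hx : 0 < x (Fin.last m)) {q : ℝ≥0∞} (hq : 1 ≤ q) {z : Space m} (hz : ‖z‖ = 1) :
    eLpNorm (fun w => inner ℝ (gradKernel a t x w) z) q (volume.restrict (layer m t)) ≤
      eLpNorm (fun w => inner ℝ (gradKernel a t x w) (eLast m)) q
        (volume.restrict (layer m t)) := by
  have hfin : ∀ r : ℝ≥0∞, 1 ≤ r → r ≠ ∞ →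
      eLpNorm (fun w => inner ℝ (gradKernel a t x w) z) r (volume.restrict (layer m t)) ≤
      eLpNorm (fun w => inner ℝ (gradKernel a t x w) (eLast m)) r
        (volume.restrict (layer m t)) := by
    intro r hr1 hrt
    have hQ : 1 ≤ r.toReal := by
      rw [← ENNReal.toReal_one]; exact ENNReal.toReal_mono hrt hr1
    rw [← ENNReal.ofReal_toReal hrt, eLpNorm_inner_gradKernel ha ht hQ hx,
      eLpNorm_inner_gradKernel ha ht hQ hx]
    gcongr
    exact sphereLIntegral_le ht hQ hz
  -- The sphere formula covers finite exponents only; the inequality passes to `q = ∞` in the limit.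
  by_cases hqt : q = ∞
  · subst hqt
    refine le_of_tendsto_of_tendsto
      (tendsto_eLpNorm_exponent_top (memLp_inner_gradKernel ha hx le_rfl z)
        (memLp_inner_gradKernel ha hx le_top z))
      (tendsto_eLpNorm_exponent_top (memLp_inner_gradKernel ha hx le_rfl (eLast m))
        (memLp_inner_gradKernel ha hx le_top (eLast m))) ?_
    have hge : ∀ᶠ r : ℝ≥0∞ in 𝓝[≠] ∞, 1 ≤ r ∧ r ≠ ∞ :=
      ((eventually_gt_nhds (by simp : (1 : ℝ≥0∞) < ∞)).filter_mono nhdsWithin_le_nhds).mono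
        (fun r hr => hr.le) |>.and eventually_mem_nhdsWithin
    filter_upwards [hge] with r hr using hfin r hr.1 hr.2
  · exact hfin q hq hqt

theorem sphereFunctional_eq {a t h : ℝ} (ht : 0 < t) {p : ℝ≥0∞} (hp : 1 < p) (z : Space m) :
    sphereFunctional m a p h t z =
      (sphereLIntegral m a t (conj p) h z).toReal ^ (1 / conj p) := by
  have hmono := weight_monotone_of_one_le (m := m) (a := a) (h := h) ht (one_le_conj hp)
  have hQ := one_le_conj hp
  unfold sphereFunctional sphereLIntegral
  rw [one_sub_recip hp, weightExp_eq _ hp]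
  congr 1
  simp only [← weight_abs, kappa, lam]
  rw [integral_eq_lintegral_of_nonneg_ae]
  · congr 1
    refine lintegral_congr fun σ => ?_
    rw [← ENNReal.ofReal_mul (weight_nonneg (by positivity) _ _ _)]
  · refine Eventually.of_forall fun σ => mul_nonneg (weight_nonneg (by positivity) _ _ _) ?_
    positivity
  · have := hmono.measurable
    exact (by fun_prop : Measurable _).aestronglyMeasurable

theorem gradConst_mul_eLpNorm {a t : ℝ} (ha : a ≠ 0) (ht : 0 < t) {x : Space m}
    (hx : 0 < x (Fin.last m)) {p : ℝ≥0∞} (hp : 1 < p) (z : Space m) :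
    gradConst (m + 1) a * (eLpNorm (fun w => inner ℝ (gradKernel a t x w) z) p.conjExponent
        (volume.restrict (layer m t))).toReal =
      prefactor (m + 1) a p (x (Fin.last m)) *
        sphereFunctional m a p (x (Fin.last m)) t z := by
  have hQ := one_le_conj hp
  have hK := kernelConst_pos m ha hx (zero_lt_one.trans_le hQ)
  rw [← ofReal_conj hp, eLpNorm_inner_gradKernel ha ht hQ hx, ← ENNReal.toReal_rpow,
    ENNReal.toReal_mul, ENNReal.toReal_ofReal hK.le,
    Real.mul_rpow hK.le ENNReal.toReal_nonneg, ← mul_assoc, gradConst_mul_kernelConst ha hx hp,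
    sphereFunctional_eq ht hp]

/-- Passing to real values requires finiteness of the integral at `e_n`; it is obtained from the
kernel's membership in `L^q`, so the comparison is made on kernel norms. -/
theorem sphereFunctional_le {a t : ℝ} (ha : a ≠ 0) (ht : 0 < t) {x : Space m}
    (hx : 0 < x (Fin.last m)) {p : ℝ≥0∞} (hp : 1 < p) {z : Space m} (hz : ‖z‖ = 1) :
    sphereFunctional m a p (x (Fin.last m)) t z ≤
      sphereFunctional m a p (x (Fin.last m)) t (eLast m) := by
  have hq : 1 ≤ p.conjExponent := by
    have := ENNReal.HolderConjugate.conjExponent hp.le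
    exact ENNReal.HolderConjugate.one_le p.conjExponent p
  have hQ := one_le_conj hp
  have hpre : 0 < prefactor (m + 1) a p (x (Fin.last m)) := by
    rw [← gradConst_mul_kernelConst ha hx hp]
    exact mul_pos (gradConst_pos _ ha)
      (Real.rpow_pos_of_pos (kernelConst_pos m ha hx (zero_lt_one.trans_le hQ)) _)
  refine le_of_mul_le_mul_left ?_ hpre
  rw [← gradConst_mul_eLpNorm ha ht hx hp, ← gradConst_mul_eLpNorm ha ht hx hp]
  refine mul_le_mul_of_nonneg_left ?_ (gradConst_pos _ ha).le
  exact ENNReal.toReal_mono (memLp_inner_gradKernel ha hx hq _).2.ne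
    (eLpNorm_inner_gradKernel_le ha ht hx hq hz)

/-! ### The sharp constant and its limit at `p = 1` -/

theorem inner_integral_smul_gradKernel {a t : ℝ} (ha : a ≠ 0) {p : ℝ≥0∞} (hp : 1 ≤ p)
    {f : Bdry m × ℝ → ℝ} (hf : MemLp f p (volume.restrict (layer m t)))
    {x : Space m} (hx : 0 < x (Fin.last m)) (z : Space m) :
    inner ℝ (∫ w in layer m t, f w • gradKernel a t x w) z =
      ∫ w in layer m t, f w * inner ℝ (gradKernel a t x w) z := by
  rw [real_inner_comm, ← integral_inner (integrable_smul_gradKernel ha hp hf hx)]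
  refine integral_congr_ae (Eventually.of_forall fun w => ?_)
  simp only
  rw [real_inner_comm, real_inner_smul_left]

theorem norm_gradient_potential_div {a t : ℝ} (ha : a ≠ 0) {p : ℝ≥0∞} (hp : 1 ≤ p)
    {f : Bdry m × ℝ → ℝ} (hf : IsData p f) {x : Space m} (hx : 0 < x (Fin.last m)) :
    ‖gradient (fun ξ : Space m => potential a f ξ t / ξ (Fin.last m)) x‖ =
      gradConst (m + 1) a * ‖∫ w in layer m t, f w • gradKernel a t x w‖ := by
  rw [(hasGradientAt_potential_div ha hp hf hx).gradient, norm_smul, norm_neg,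
    Real.norm_of_nonneg (gradConst_pos _ ha).le]

theorem isData_indicator_layer {p : ℝ≥0∞} {f : Bdry m × ℝ → ℝ} {t : ℝ}
    (hf : MemLp f p (volume.restrict (layer m t))) : IsData p ((layer m t).indicator f) := by
  rw [IsData, memLp_indicator_iff_restrict (measurableSet_layer t),
    Measure.restrict_restrict (measurableSet_layer t)]
  rwa [Set.inter_eq_left.2]
  exact Set.prod_mono_right fun _ h => h.1

theorem inner_gradKernel_eLast_pos {a t : ℝ} {x : Space m} (hx : 0 < x (Fin.last m))
    {w : Bdry m × ℝ} (hw : w ∈ layer m t) : 0 < inner ℝ (gradKernel a t x w) (eLast m) := by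
  have hs : 0 < t - w.2 := sub_pos.2 (mem_layer.1 hw).2
  rw [gradKernel, real_inner_smul_left, inner_eLast, sub_bdryPoint_last]
  positivity

theorem volume_layer_ne_zero {t : ℝ} (ht : 0 < t) :
    (volume : Measure (Bdry m × ℝ)) (layer m t) ≠ 0 :=
  ((isOpen_univ.prod isOpen_Ioo).measure_pos _
    ⟨(0, t / 2), Set.mem_univ _, by constructor <;> simp <;> linarith⟩).ne'

/-- Admissibility is Hölder in the direction of the vector integral, followed by comparison with
`e_n`. Minimality looks only at the `e_n` component, where the kernel is positive and the converse
of Hölder applies. -/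
theorem isLeast_admissible {a t : ℝ} (ha : a ≠ 0) (ht : 0 < t) {x : Space m}
    (hx : 0 < x (Fin.last m)) {p : ℝ≥0∞} (hp : 1 ≤ p) :
    IsLeast (admissible a p x t)
      (gradConst (m + 1) a * (eLpNorm (fun w => inner ℝ (gradKernel a t x w) (eLast m))
        p.conjExponent (volume.restrict (layer m t))).toReal) := by
  have hpq := ENNReal.HolderConjugate.conjExponent hp
  have hq : 1 ≤ p.conjExponent := ENNReal.HolderConjugate.one_le p.conjExponent p
  have hC := gradConst_pos (m + 1) ha
  set μ := (volume : Measure (Bdry m × ℝ)).restrict (layer m t) with hμ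
  set q := p.conjExponent with hqdef
  refine ⟨fun f hf => ?_, fun C hCa => ?_⟩
  · rw [norm_gradient_potential_div ha hp hf hx, mul_assoc]
    refine mul_le_mul_of_nonneg_left ?_ hC.le
    set V := ∫ w in layer m t, f w • gradKernel a t x w with hV
    by_cases hV0 : V = 0
    · rw [hV0, norm_zero]
      exact mul_nonneg ENNReal.toReal_nonneg ENNReal.toReal_nonneg
    have hVn : 0 < ‖V‖ := norm_pos_iff.2 hV0
    have hz : ‖‖V‖⁻¹ • V‖ = 1 := by
      rw [norm_smul, norm_inv, norm_norm, inv_mul_cancel₀ hVn.ne']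
    have h1 : inner ℝ V (‖V‖⁻¹ • V) = ‖V‖ := by
      rw [real_inner_smul_right, real_inner_self_eq_norm_sq]
      field_simp
    have hfl := hf.memLp_layer t
    rw [← h1, hV, inner_integral_smul_gradKernel ha hp hfl hx, ← hV]
    refine (le_abs_self _).trans ((abs_integral_mul_le_eLpNorm (q := q) hfl
      (memLp_inner_gradKernel ha hx hq _)).trans ?_)
    refine mul_le_mul_of_nonneg_right ?_ ENNReal.toReal_nonneg
    exact ENNReal.toReal_mono (memLp_inner_gradKernel ha hx hq _).2.ne
      (eLpNorm_inner_gradKernel_le ha ht hx hq hz)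
  -- The duality lemma wants nonnegativity everywhere, while the kernel has a controlled sign only
  -- for `τ < t`.
  · set g := (layer m t).indicator fun w => inner ℝ (gradKernel a t x w) (eLast m) with hg
    have hgae : g =ᵐ[μ] fun w => inner ℝ (gradKernel a t x w) (eLast m) :=
      indicator_ae_eq_restrict (measurableSet_layer t)
    have hgL : ∀ r : ℝ≥0∞, 1 ≤ r → MemLp g r μ := fun r hr =>
      (memLp_congr_ae hgae).2 (memLp_inner_gradKernel ha hx hr _)
    rw [← eLpNorm_congr_ae hgae, ← le_div_iff₀' hC]
    refine toReal_eLpNorm_le_of_forall_integral_mul_le (p := p) (q := q) ?_ ?_ ?_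
      (hgL 1 le_rfl) (hgL ∞ le_top) ?_
    · exact Set.indicator_nonneg fun w hw => (inner_gradKernel_eLast_pos hx hw).le
    · exact (by fun_prop : Measurable fun w => inner ℝ (gradKernel a t x w) (eLast m)).indicator
        (measurableSet_layer t)
    · intro h0
      refine volume_layer_ne_zero (m := m) ht ?_
      have h1 : ∀ᵐ w ∂μ, False := by
        filter_upwards [h0, hgae, ae_restrict_mem (measurableSet_layer t)] with w h2 h3 hw
        rw [h3] at h2
        exact (inner_gradKernel_eLast_pos hx hw).ne' h2
      rwa [eventually_false_iff_eq_bot, ae_eq_bot, Measure.restrict_eq_zero] at h1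
    · intro f hfm hf
      have hF := isData_indicator_layer hf
      have hFae : (layer m t).indicator f =ᵐ[μ] f :=
        indicator_ae_eq_restrict (measurableSet_layer t)
      have h := hCa _ hF
      rw [norm_gradient_potential_div ha hp hF hx, layerNorm, eLpNorm_congr_ae hFae] at h
      rw [div_mul_eq_mul_div, le_div_iff₀' hC]
      refine le_trans (mul_le_mul_of_nonneg_left ?_ hC.le) h
      have h2 := abs_real_inner_le_norm
        (∫ w in layer m t, (layer m t).indicator f w • gradKernel a t x w) (eLast m)
      rw [norm_eLast, mul_one,
        inner_integral_smul_gradKernel ha hp (hF.memLp_layer t) hx] at h2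
      refine le_trans (le_of_eq ?_) h2
      congr 1
      refine integral_congr_ae ?_
      filter_upwards [hFae, hgae] with w h3 h4
      rw [h3, h4]

theorem sharpCoeff_eq {a t : ℝ} (ha : a ≠ 0) (ht : 0 < t) {x : Space m}
    (hx : 0 < x (Fin.last m)) {p : ℝ≥0∞} (hp : 1 ≤ p) :
    sharpCoeff a p x t =
      gradConst (m + 1) a * (eLpNorm (fun w => inner ℝ (gradKernel a t x w) (eLast m))
        p.conjExponent (volume.restrict (layer m t))).toReal :=
  (isLeast_admissible ha ht hx hp).csInf_eq

theorem tendsto_sharpCoeff_one {a t : ℝ} (ha : a ≠ 0) (ht : 0 < t) {x : Space m}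
    (hx : 0 < x (Fin.last m)) :
    Tendsto (fun p : ℝ≥0∞ => sharpCoeff a p x t) (𝓝[>] 1) (𝓝 (sharpCoeff a 1 x t)) := by
  have hev : ∀ᶠ p : ℝ≥0∞ in 𝓝[>] 1, 1 < p := eventually_mem_nhdsWithin
  -- The conjugate exponent tends to `∞` through finite values, so the limit theorem for `L^r` norms
  -- applies.
  have hconj : Tendsto ENNReal.conjExponent (𝓝[>] 1) (𝓝[≠] ∞) := by
    refine tendsto_nhdsWithin_iff.2 ⟨?_, ?_⟩
    · have hsub : Tendsto (fun p : ℝ≥0∞ => p - 1) (𝓝 1) (𝓝 (1 - 1)) :=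
        ENNReal.Tendsto.sub tendsto_id tendsto_const_nhds (Or.inl ENNReal.one_ne_top)
      have h : Tendsto (fun p : ℝ≥0∞ => 1 + (p - 1)⁻¹) (𝓝 1) (𝓝 (1 + (1 - 1)⁻¹)) :=
        tendsto_const_nhds.add (tendsto_inv_iff.2 hsub)
      simp only [tsub_self, ENNReal.inv_zero, add_top] at h
      exact h.mono_left nhdsWithin_le_nhds
    · filter_upwards [hev] with p hp
      rw [← ofReal_conj hp]
      exact ENNReal.ofReal_ne_top
  have h1 : (1 : ℝ≥0∞).conjExponent = ∞ := by simp [ENNReal.conjExponent]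
  rw [sharpCoeff_eq ha ht hx le_rfl, h1]
  refine Tendsto.congr' (hev.mono fun p hp => (sharpCoeff_eq ha ht hx hp.le).symm) ?_
  refine Tendsto.const_mul _ ((ENNReal.tendsto_toReal
    (memLp_inner_gradKernel ha hx le_top (eLast m)).2.ne).comp ?_)
  exact (tendsto_eLpNorm_exponent_top (memLp_inner_gradKernel ha hx le_rfl (eLast m))
    (memLp_inner_gradKernel ha hx le_top (eLast m))).comp hconj

/-! ### The explicit formula in the polar angle -/

theorem image_tan_Ioo : Real.tan '' Set.Ioo 0 (Real.pi / 2) = Set.Ioi 0 := by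
  ext r
  simp only [Set.mem_image, Set.mem_Ioi]
  constructor
  · rintro ⟨θ, hθ, rfl⟩
    exact Real.tan_pos_of_pos_of_lt_pi_div_two hθ.1 hθ.2
  · intro hr
    exact ⟨Real.arctan r, ⟨Real.arctan_pos.2 hr, Real.arctan_lt_pi_div_two r⟩, Real.tan_arctan r⟩

theorem lintegral_Ioi_eq_lintegral_tan (η : ℝ → ℝ≥0∞) :
    ∫⁻ r in Set.Ioi (0 : ℝ), η r =
      ∫⁻ θ in Set.Ioo 0 (Real.pi / 2), ENNReal.ofReal |1 / Real.cos θ ^ 2| * η (Real.tan θ) := by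
  have hpi := Real.pi_pos
  have hcos : ∀ θ ∈ Set.Ioo 0 (Real.pi / 2), 0 < Real.cos θ := fun θ hθ =>
    Real.cos_pos_of_mem_Ioo ⟨by linarith [hθ.1], hθ.2⟩
  rw [← image_tan_Ioo]
  refine lintegral_image_eq_lintegral_abs_deriv_mul measurableSet_Ioo
    (fun θ hθ => (Real.hasDerivAt_tan (hcos θ hθ).ne').hasDerivWithinAt) ?_ η
  refine Real.injOn_tan.mono (fun θ hθ => ?_)
  exact ⟨by linarith [hθ.1], hθ.2⟩

theorem lintegral_norm_eq_lintegral_tan (hm : 1 ≤ m) {η : ℝ → ℝ≥0∞} (hη : Measurable η) :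
    ∫⁻ w : Bdry m, η ‖w‖ = (volume : Measure (Bdry m)).toSphere Set.univ *
      ∫⁻ θ in Set.Ioo 0 (Real.pi / 2), ENNReal.ofReal |1 / Real.cos θ ^ 2| *
        (ENNReal.ofReal (Real.tan θ ^ (m - 1)) * η (Real.tan θ)) := by
  have : Nonempty (Fin m) := ⟨⟨0, hm⟩⟩
  have : Nontrivial (Bdry m) := inferInstance
  rw [lintegral_eq_lintegral_toSphere volume (by fun_prop : Measurable fun w : Bdry m => η ‖w‖),
    ← lintegral_Ioi_eq_lintegral_tan (fun r => ENNReal.ofReal (r ^ (m - 1)) * η r), mul_comm,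
    ← lintegral_const]
  refine lintegral_congr fun σ => setLIntegral_congr_fun measurableSet_Ioi fun r hr => ?_
  have hr0 : (0 : ℝ) < r := hr
  have hσ : ‖(σ : Bdry m)‖ = 1 := by simp
  simp only [norm_smul, hσ, mul_one, Real.norm_of_nonneg hr0.le, finrank_euclideanSpace,
    Fintype.card_fin]

/-- The integral of a function of the last coordinate over the unit sphere. -/
theorem lintegral_toSphere_last (hm : 1 ≤ m) {Ψ : ℝ → ℝ} (hΨ0 : Ψ 0 = 0)
    (hΨm : Measurable Ψ) :
    ∫⁻ σ : Metric.sphere (0 : Space m) 1, ENNReal.ofReal (Ψ |(σ : Space m) (Fin.last m)|)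
        ∂(volume : Measure (Space m)).toSphere =
      2 * ((volume : Measure (Bdry m)).toSphere Set.univ *
        ∫⁻ θ in Set.Ioo 0 (Real.pi / 2),
          ENNReal.ofReal (Ψ (Real.cos θ) * Real.sin θ ^ (m - 1))) := by
  have hpi := Real.pi_pos
  -- With `r = tan θ` this is `Ψ(cos θ) cos^{m+1} θ`. The power cancels the Jacobian of central
  -- projection, and with `tan^{m-1} θ / cos² θ` it leaves `sin^{m-1} θ`.
  set η : ℝ → ℝ≥0∞ := fun r =>
    ENNReal.ofReal (Ψ (√(1 + r ^ 2))⁻¹ * (√(1 + r ^ 2))⁻¹ ^ (m + 1)) with hη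
  have hηm : Measurable η := by fun_prop
  have hrad := lintegral_norm_eq_lintegral_tan hm hηm
  have hθ : ∫⁻ θ in Set.Ioo 0 (Real.pi / 2), ENNReal.ofReal |1 / Real.cos θ ^ 2| *
        (ENNReal.ofReal (Real.tan θ ^ (m - 1)) * η (Real.tan θ)) =
      ∫⁻ θ in Set.Ioo 0 (Real.pi / 2),
          ENNReal.ofReal (Ψ (Real.cos θ) * Real.sin θ ^ (m - 1)) := by
    refine setLIntegral_congr_fun measurableSet_Ioo fun θ hθ => ?_
    have hcos : 0 < Real.cos θ := Real.cos_pos_of_mem_Ioo ⟨by linarith [hθ.1], hθ.2⟩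
    have htan : 0 < Real.tan θ := Real.tan_pos_of_pos_of_lt_pi_div_two hθ.1 hθ.2
    simp only [hη]
    rw [Real.inv_sqrt_one_add_tan_sq hcos, ← ENNReal.ofReal_mul (by positivity),
      ← ENNReal.ofReal_mul (by positivity), abs_of_pos (by positivity), Real.tan_eq_sin_div_cos]
    congr 1
    obtain ⟨k, rfl⟩ : ∃ k, m = k + 1 := ⟨m - 1, by omega⟩
    rw [Nat.add_sub_cancel, div_pow]
    field_simp
    ring
  rw [← hθ, ← hrad, two_mul_lintegral_eq_lintegral_toSphere (by fun_prop)]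
  refine lintegral_congr fun σ => ?_
  set c := (σ : Space m) (Fin.last m) with hc
  by_cases hc0 : c = 0
  · simp [hc0, hΨ0]
  have hc1 : 0 < |c| := abs_pos.2 hc0
  have hσ : ‖(σ : Space m)‖ = 1 := by simp
  have hnorm : (√(1 + ‖c⁻¹ • tangential (σ : Space m)‖ ^ 2))⁻¹ = |c| := by
    have h1 := norm_sq_eq_tangential (σ : Space m)
    rw [hσ, ← hc] at h1
    have h2 : 1 + ‖c⁻¹ • tangential (σ : Space m)‖ ^ 2 = (|c|⁻¹) ^ 2 := by
      rw [norm_smul, norm_inv, Real.norm_eq_abs, mul_pow, inv_pow, sq_abs]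
      field_simp
      linarith
    rw [h2, Real.sqrt_sq (by positivity), inv_inv]
  simp only [hη, hnorm]
  rw [← ENNReal.ofReal_mul (by positivity)]
  congr 1
  rw [mul_left_comm, ← mul_pow, inv_mul_cancel₀ hc1.ne', one_pow, mul_one]

theorem sphereLIntegral_eLast (hm : 1 ≤ m) {a t h : ℝ} (ht : 0 < t)
    {p : ℝ≥0∞} (hp : 1 < p) :
    (sphereLIntegral m a t (conj p) h (eLast m)).toReal =
      2 * sphereArea m * ∫ θ in (0 : ℝ)..(Real.pi / 2),
        (∫ ξ in Set.Ioi (conj p * h ^ 2 / (4 * a ^ 2 * t * Real.cos θ ^ 2)),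
            ξ ^ lam (m + 1) p * Real.exp (-ξ)) *
          Real.cos θ ^ cosExp (m + 1) p * Real.sin θ ^ (m - 1) := by
  have hpi := Real.pi_pos
  have hQ := one_le_conj hp
  have hm0 : (0 : ℝ) ≤ m := Nat.cast_nonneg m
  have hα : 0 ≤ weightExp (m + 1) p := by
    rw [weightExp_eq _ hp]
    push_cast
    nlinarith
  have hβ : 0 ≤ cosExp (m + 1) p := by
    rw [cosExp_eq]; linarith
  have hκ : 0 ≤ kappa a p h t := by unfold kappa; positivity
  have hl : -1 < lam (m + 1) p := by
    unfold lam
    push_cast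
    nlinarith
  -- At `z = e_n` the factor `|(σ,z)|^q` merges with the weight, raising its exponent by `q`.
  set Ψ : ℝ → ℝ := weight (kappa a p h t) (lam (m + 1) p) (cosExp (m + 1) p) with hΨ
  have hΨ0 : Ψ 0 = 0 := by simp [hΨ, weight, omega]
  have hΨn : ∀ u, 0 ≤ Ψ u := weight_nonneg hκ _ _
  have hΨm : Measurable Ψ := (weight_monotone hκ hl hβ).measurable
  have h1 : sphereLIntegral m a t (conj p) h (eLast m) =
      ∫⁻ σ : Metric.sphere (0 : Space m) 1, ENNReal.ofReal (Ψ |(σ : Space m) (Fin.last m)|)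
        ∂(volume : Measure (Space m)).toSphere := by
    unfold sphereLIntegral
    refine lintegral_congr fun σ => ?_
    rw [inner_eLast, hΨ, weight_abs, weight_abs,
      ← ENNReal.ofReal_mul (mul_nonneg (omega_nonneg (by positivity) _) (by positivity)), cosExp_eq,
      Real.rpow_add_of_nonneg (abs_nonneg _) hα (by linarith), weightExp_eq _ hp, mul_assoc]
    rfl
  have h2 : ∫ θ in (0 : ℝ)..(Real.pi / 2),
        (∫ ξ in Set.Ioi (conj p * h ^ 2 / (4 * a ^ 2 * t * Real.cos θ ^ 2)),
            ξ ^ lam (m + 1) p * Real.exp (-ξ)) *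
          Real.cos θ ^ cosExp (m + 1) p * Real.sin θ ^ (m - 1) =
      (∫⁻ θ in Set.Ioo 0 (Real.pi / 2),
          ENNReal.ofReal (Ψ (Real.cos θ) * Real.sin θ ^ (m - 1))).toReal := by
    rw [intervalIntegral.integral_of_le (by positivity), integral_Ioc_eq_integral_Ioo,
      ← integral_eq_lintegral_of_nonneg_ae]
    · refine setIntegral_congr_fun measurableSet_Ioo fun θ hθ => ?_
      have hcos : 0 < Real.cos θ := Real.cos_pos_of_mem_Ioo ⟨by linarith [hθ.1], hθ.2⟩
      simp only [hΨ, weight, max_eq_left hcos.le, omega, if_neg hcos.ne', kappa, div_div]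
    · filter_upwards [ae_restrict_mem measurableSet_Ioo] with θ hθ
      have : 0 < Real.sin θ := Real.sin_pos_of_pos_of_lt_pi hθ.1 (by linarith [hθ.2])
      exact mul_nonneg (hΨn _) (by positivity)
    · exact (by fun_prop : Measurable _).aestronglyMeasurable
  rw [h1, h2, lintegral_toSphere_last hm hΨ0 hΨm, ENNReal.toReal_mul, ENNReal.toReal_mul,
    ← mul_assoc]
  rfl

theorem prefactor_mul_sphereFunctional_eLast (hm : 1 ≤ m) {a t h : ℝ} (ht : 0 < t)
    {p : ℝ≥0∞} (hp : 1 < p) :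
    prefactor (m + 1) a p h * sphereFunctional m a p h t (eLast m) =
      explicitCoeff (m + 1) a p h t := by
  rw [sphereFunctional_eq ht hp, sphereLIntegral_eLast hm ht hp, explicitCoeff, one_sub_recip hp]
  rfl

theorem sphereArea_eq (hm : 1 ≤ m) :
    sphereArea m = 2 * √Real.pi ^ m / Real.Gamma ((m : ℝ) / 2) := by
  have : Nonempty (Fin m) := ⟨⟨0, hm⟩⟩
  have hm0 : (0 : ℝ) < m := by exact_mod_cast hm
  have hpi := Real.pi_pos
  have hG : 0 < Real.Gamma ((m : ℝ) / 2) := Real.Gamma_pos_of_pos (by positivity)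
  unfold sphereArea
  rw [Measure.toSphere_real_apply_univ, measureReal_def, EuclideanSpace.volume_ball,
    Fintype.card_fin, finrank_euclideanSpace, Fintype.card_fin, Real.Gamma_add_one (by positivity)]
  rw [ENNReal.ofReal_one, one_pow, one_mul, ENNReal.toReal_ofReal (by positivity)]
  field_simp

theorem explicitCoeff_top (hm : 1 ≤ m) (a : ℝ) {h : ℝ} (t : ℝ) :
    explicitCoeff (m + 1) a ∞ h t = explicitCoeffTop (m + 1) a h t := by
  have hpi := Real.pi_pos
  have hm0 : (0 : ℝ) < m := by exact_mod_cast hm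
  have hG : 0 < Real.Gamma ((m : ℝ) / 2) := Real.Gamma_pos_of_pos (by positivity)
  have hlam : lam (m + 1) ∞ = ((m + 1 : ℕ) : ℝ) / 2 := by
    simp only [lam, conj, if_true]
    ring
  have hcos : cosExp (m + 1) ∞ = 2 := by simp [cosExp]
  have hrec : recip ∞ = 0 := by simp [recip]
  have hconj : conj ∞ = 1 := by simp [conj]
  have hpow : Real.pi ^ (((m + 1 : ℕ) : ℝ) / 2) = √Real.pi ^ m * √Real.pi := by
    rw [← pow_succ, Real.sqrt_eq_rpow, ← Real.rpow_natCast, ← Real.rpow_mul hpi.le]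
    congr 1
    ring
  have hs : 0 < √Real.pi := Real.sqrt_pos.2 hpi
  unfold explicitCoeff explicitCoeffTop prefactor cConst
  rw [hlam, hcos, hrec, hconj, hpow, Nat.add_sub_cancel, sphereArea_eq hm]
  simp only [Real.rpow_two, one_mul, sub_zero, Real.rpow_one, Real.rpow_zero, Real.one_rpow,
    mul_zero, add_zero, mul_one, Nat.cast_add, Nat.cast_one, add_sub_cancel_right]
  rw [← mul_assoc]
  congr 1
  by_cases hh : h = 0
  · simp [hh]
  field_simp
  norm_num

end HeatDirichlet

end

/-! ### The main theorem -/

theorem mainTheorem1 (m : ℕ) (hm : 1 ≤ m) (a : ℝ) (ha : a ≠ 0)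
    (x : HeatDirichlet.Space m) (hx : 0 < x (Fin.last m)) (t : ℝ) (ht : 0 < t) :
    -- the potential is well defined and the gradient in question exists
    (∀ p : ℝ≥0∞, 1 ≤ p → ∀ f : HeatDirichlet.Bdry m × ℝ → ℝ, HeatDirichlet.IsData p f →
      (∀ ξ : HeatDirichlet.Space m, 0 < ξ (Fin.last m) →
        MeasureTheory.IntegrableOn (HeatDirichlet.potentialIntegrand a f ξ t)
          (HeatDirichlet.layer m t)) ∧
      DifferentiableAt ℝ
        (fun ξ : HeatDirichlet.Space m =>
          HeatDirichlet.potential a f ξ t / ξ (Fin.last m)) x) ∧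
    -- the sharp coefficient is itself admissible
    (∀ p : ℝ≥0∞, 1 ≤ p →
      IsLeast (HeatDirichlet.admissible a p x t) (HeatDirichlet.sharpCoeff a p x t)) ∧
    -- the representation of the sharp coefficient for `1 < p ≤ ∞`
    (∀ p : ℝ≥0∞, 1 < p → ∃ M : ℝ,
      IsGreatest
        (HeatDirichlet.sphereFunctional m a p (x (Fin.last m)) t ''
          Metric.sphere (0 : HeatDirichlet.Space m) 1) M ∧
      HeatDirichlet.sharpCoeff a p x t =
        HeatDirichlet.prefactor (m + 1) a p (x (Fin.last m)) * M) ∧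
    -- the endpoint `p = 1`, where the representation is read as a limit
    Filter.Tendsto (fun p : ℝ≥0∞ => HeatDirichlet.sharpCoeff a p x t) (𝓝[>] 1)
      (𝓝 (HeatDirichlet.sharpCoeff a 1 x t)) ∧
    -- the solution of the extremal problem for `2 ≤ p ≤ ∞`
    (∀ p : ℝ≥0∞, 2 ≤ p →
      IsMaxOn (HeatDirichlet.sphereFunctional m a p (x (Fin.last m)) t)
        (Metric.sphere (0 : HeatDirichlet.Space m) 1) (HeatDirichlet.eLast m) ∧
      HeatDirichlet.sharpCoeff a p x t =
        HeatDirichlet.explicitCoeff (m + 1) a p (x (Fin.last m)) t) ∧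
    -- the case `p = ∞`
    HeatDirichlet.sharpCoeff a ∞ x t =
      HeatDirichlet.explicitCoeffTop (m + 1) a (x (Fin.last m)) t := by
  have hmax : ∀ p : ℝ≥0∞, 1 < p → ∀ z ∈ Metric.sphere (0 : HeatDirichlet.Space m) 1,
      HeatDirichlet.sphereFunctional m a p (x (Fin.last m)) t z ≤
        HeatDirichlet.sphereFunctional m a p (x (Fin.last m)) t (HeatDirichlet.eLast m) :=
    fun p hp z hz => HeatDirichlet.sphereFunctional_le ha ht hx hp (by simpa using hz)
  have hrep : ∀ p : ℝ≥0∞, 1 < p → HeatDirichlet.sharpCoeff a p x t =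
      HeatDirichlet.prefactor (m + 1) a p (x (Fin.last m)) *
        HeatDirichlet.sphereFunctional m a p (x (Fin.last m)) t (HeatDirichlet.eLast m) :=
    fun p hp => by
      rw [HeatDirichlet.sharpCoeff_eq ha ht hx hp.le,
        HeatDirichlet.gradConst_mul_eLpNorm ha ht hx hp]
  have hexp : ∀ p : ℝ≥0∞, 1 < p → HeatDirichlet.sharpCoeff a p x t =
      HeatDirichlet.explicitCoeff (m + 1) a p (x (Fin.last m)) t := fun p hp => by
    rw [hrep p hp, HeatDirichlet.prefactor_mul_sphereFunctional_eLast hm ht hp]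
  refine ⟨fun p hp f hf => ⟨fun ξ hξ => ?_, ?_⟩, fun p hp => ?_, fun p hp => ?_, ?_,
    fun p hp => ⟨?_, ?_⟩, ?_⟩
  · exact HeatDirichlet.integrableOn_potentialIntegrand ha hp hf hξ
  · exact (HeatDirichlet.hasGradientAt_potential_div ha hp hf hx).differentiableAt
  · rw [HeatDirichlet.sharpCoeff_eq ha ht hx hp]
    exact HeatDirichlet.isLeast_admissible ha ht hx hp
  · refine ⟨_, ⟨⟨HeatDirichlet.eLast m, ?_, rfl⟩, ?_⟩, hrep p hp⟩
    · simp [HeatDirichlet.norm_eLast]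
    · rintro _ ⟨z, hz, rfl⟩
      exact hmax p hp z hz
  · exact HeatDirichlet.tendsto_sharpCoeff_one ha ht hx
  · exact fun z hz => hmax p (ENNReal.one_lt_two.trans_le hp) z hz
  · exact hexp p (ENNReal.one_lt_two.trans_le hp)
  · rw [hexp ∞ ENNReal.one_lt_top, HeatDirichlet.explicitCoeff_top hm]
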